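/- Let $\mathcal P_k=\mathbb F_2[x_1,\dots,x_k]$, all variables in degree $1$, with the usual action of the mod-$2$ Steenrod algebra: the squares $Sq^i$ are determined by $Sq^0(x_j)=x_j$, $Sq^1(x_j)=x_j^2$, $Sq^i(x_j)=0$ for $i>1$, and the Cartan formula. Let $(\mathcal P_k)_n$ be the space of homogeneous polynomials of degree $n$, let $H_n\subseteq(\mathcal P_k)_n$ be the subspace of hit polynomials, i.e. those of the form $\sum_{i>0}Sq^i(f_i)$ (finite sum, $f_i\in\mathcal P_k$), and let $(Q\mathcal P_k)_n=(\mathcal P_k)_n/H_n$, with $[f]$ the class of $f$. The group $GL_k(\mathbb F_2)$ acts on $(Q\mathcal P_k)_n$ by linear substitution of the variables, and $\Sigma_k\subset GL_k(\mathbb F_2)$ acts by permuting the variables. For $n-k\ge 0$ even, the Kameko homomorphism $(\widetilde{Sq^0_*})_{(k,n)}:(Q\mathcal P_k)_n\to(Q\mathcal P_k)_{(n-k)/2}$ is the linear map sending $[x_1^{a_1}\cdots x_k^{a_k}]$ to $[x_1^{(a_1-1)/2}\cdots x_k^{(a_k-1)/2}]$ if all $a_j$ are odd, and to $0$ otherwise.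 Let $\psi:\mathcal P_4\to\mathcal P_4$, $\psi(u)=x_1x_2x_3x_4u^2$. Then the following hold for $k=4$ and $n=32$. 1. The Kameko homomorphism $(\widetilde{Sq^0_*})_{(4,32)}:(Q\mathcal P_4)_{32}\to(Q\mathcal P_4)_{14}$ is surjective, and $(Q\mathcal P_4)_{14}^{GL_4(\mathbb F_2)}$ has dimension $1$ and is spanned by $[x_1x_2x_3^6x_4^6+x_1^3x_2^3x_3^4x_4^4]$. 2. $\dim (Q\mathcal P_4)_{32}=95$. 3. $\dim (Q\mathcal P_4)_{32}^{\Sigma_4}=11$, and the classes $[\mathrm{Sigma}_4[1]],\dots,[\mathrm{Sigma}_4[11]]$ form a basis of $(Q\mathcal P_4)_{32}^{\Sigma_4}$, where \begin{align*} \mathrm{Sigma}_4[1] &= x_1 x_2^2 x_3 x_4^{28} + x_1 x_2^2 x_3^{28} x_4 + x_1 x_2^2 x_3^4 x_4^{25} + x_1 x_2^2 x_3^5 x_4^{24} + x_1 x_2^3 x_3^4 x_4^{24} + x_1^3 x_2 x_3^4 x_4^{24}, \\ \mathrm{Sigma}_4[2] &= x_1 x_2^2 x_3^{29} + x_1 x_2^2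 x_4^{29} + x_1 x_2^3 x_3^{28} + x_1 x_2^3 x_4^{28} + x_1 x_2^{30} x_3 + x_1 x_2^{30} x_4 + x_1 x_3^2 x_4^{29} \\ &\quad + x_1 x_3^3 x_4^{28} + x_1 x_3^{30} x_4 + x_1^3 x_2 x_3^{28} + x_1^3 x_2 x_4^{28} + x_1^3 x_3 x_4^{28} + x_2 x_3^2 x_4^{29} \\ &\quad + x_2 x_3^3 x_4^{28} + x_2 x_3^{30} x_4 + x_2^3 x_3 x_4^{28}, \\ \mathrm{Sigma}_4[3] &= x_1 x_2 x_3^{15} x_4^{15} + x_1 x_2^{15} x_3 x_4^{15} + x_1 x_2^{15} x_3^{15} x_4 + x_1^{15} x_2 x_3 x_4^{15} + x_1^{15} x_2 x_3^{15} x_4 + x_1^{15} x_2^{15} x_3 x_4, \\ \mathrm{Sigma}_4[4] &= x_1 x_2^{15} x_3^3 x_4^{13} + x_1 x_2^3 x_3^{13} x_4^{15} + x_1 x_2^3 x_3^{15} x_4^{13} + x_1^{15} x_2 x_3^3 x_4^{13} + x_1^{15} x_2^3 x_3 x_4^{13} \\ &\quad + x_1^{15} x_2^3 x_3^{13} x_4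 + x_1^3 x_2 x_3^{13} x_4^{15} + x_1^3 x_2 x_3^{15} x_4^{13} + x_1^3 x_2^{13} x_3 x_4^{15} + x_1^3 x_2^{13} x_3^{15} x_4\\ &\quad + x_1^3 x_2^{15} x_3 x_4^{13} + x_1^3 x_2^{15} x_3^{13} x_4, \\ \mathrm{Sigma}_4[5] &= x_1^{15} x_2^3 x_3^5 x_4^9 + x_1^3 x_2^{15} x_3^5 x_4^9 + x_1^3 x_2^5 x_3^{15} x_4^9 + x_1^3 x_2^5 x_3^9 x_4^{15}, \\ \mathrm{Sigma}_4[6] &= x_1^{15} x_2^3 x_3^7 x_4^7 + x_1^{15} x_2^7 x_3^3 x_4^7 + x_1^{15} x_2^7 x_3^7 x_4^3 + x_1^3 x_2^{15} x_3^7 x_4^7 + x_1^3 x_2^7 x_3^{15} x_4^7 \\ &\quad + x_1^3 x_2^7 x_3^7 x_4^{15} + x_1^7 x_2^{15} x_3^3 x_4^7 + x_1^7 x_2^{15} x_3^7 x_4^3 + x_1^7 x_2^3 x_3^{15} x_4^7 \\ &\quad + x_1^7 x_2^3 x_3^7 x_4^{15} + x_1^7 x_2^7 x_3^{15} x_4^3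 + x_1^7 x_2^7 x_3^3 x_4^{15}, \\ \mathrm{Sigma}_4[7] &= x_1 x_2 x_3^2 x_4^{28} + x_1 x_2^2 x_3^4 x_4^{25} + x_1 x_2^2 x_3^5 x_4^{24} + x_1 x_2^3 x_3^4 x_4^{24} + x_1^3 x_2 x_3^4 x_4^{24}, \\ \mathrm{Sigma}_4[8] &= x_1^3 x_2^{29} + x_1^3 x_3^{29} + x_1^3 x_4^{29} + x_2^3 x_3^{29} + x_2^3 x_4^{29} + x_3^3 x_4^{29}, \\ \mathrm{Sigma}_4[9] &= x_1 x_2^{31} + x_1 x_3^{31} + x_1 x_4^{31} + x_1^{31} x_2 + x_1^{31} x_3 + x_1^{31} x_4 + x_2 x_3^{31} + x_2 x_4^{31} \\ &\quad + x_2^{31} x_3 + x_2^{31} x_4 + x_3 x_4^{31} + x_3^{31} x_4, \\ \mathrm{Sigma}_4[10] &= x_1 x_2^7 x_3^{11} x_4^{13} + x_1^7 x_2 x_3^{11} x_4^{13} + x_1^7 x_2^{11} x_3 x_4^{13} + x_1^7 x_2^{11} x_3^{13} x_4, \\ \mathrm{Sigma}_4[11] &= x_1^3 x_2^3 x_3^{13}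 x_4^{13} + x_1^7 x_2^7 x_3^9 x_4^9. \end{align*} 4. $\dim (Q\mathcal P_4)_{32}^{GL_4(\mathbb F_2)}=1$, and this space is spanned by $[\mathrm{Sigma}_4[11]]$, where $$\mathrm{Sigma}_4[11]=x_1^3x_2^3x_3^{13}x_4^{13}+x_1^7x_2^7x_3^9x_4^9=\psi(x_1x_2x_3^6x_4^6+x_1^3x_2^3x_3^4x_4^4).$$ 5. $\left[\ker (\widetilde{Sq^0_*})_{(4,32)}\right]^{GL_4(\mathbb F_2)}=0$. -/

import Mathlib

namespace HitProblem

noncomputable section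

/-- The polynomial algebra `P_k = F_2[x_1, ..., x_k]`; the variable `x_{i+1}` is `X i`. -/
abbrev Poly (k : ℕ) : Type := MvPolynomial (Fin k) (ZMod 2)

/-- The total Steenrod square `f ↦ ∑ i, Sq^i(f) T^i`: by the Cartan formula it is the algebra
homomorphism with `x ↦ x + x ^ 2 T` on each variable `x` (which has degree `1`). -/
def sqTotal (k : ℕ) : Poly k →ₐ[ZMod 2] Polynomial (Poly k) :=
  MvPolynomial.aeval fun i =>
    Polynomial.C (MvPolynomial.X i) + Polynomial.C (MvPolynomial.X i ^ 2) * Polynomial.X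

/-- The Steenrod square `Sq^i` on `P_k`. -/
def Sq (k i : ℕ) : Poly k →ₗ[ZMod 2] Poly k :=
  ((Polynomial.lcoeff (Poly k) i).restrictScalars (ZMod 2)).comp (sqTotal k).toLinearMap

/-- The subspace of hit polynomials: the positive-degree part of the Steenrod algebra applied to
`P_k`. As the `Sq^i` with `i > 0` generate that part as an ideal, it is the sum of
their images. -/
def hits (k : ℕ) : Submodule (ZMod 2) (Poly k) :=
  ⨆ i : ℕ, ⨆ _ : 0 < i, LinearMap.range (Sq k i)

/-- The homogeneous polynomials of degree `n`. -/
abbrev PolyDeg (k n : ℕ) : Submodule (ZMod 2) (Poly k) :=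
  MvPolynomial.homogeneousSubmodule (Fin k) (ZMod 2) n

/-- The hit polynomials of degree `n`, as a subspace of the polynomials of degree `n`. -/
abbrev hitsDeg (k n : ℕ) : Submodule (ZMod 2) (PolyDeg k n) :=
  (hits k).comap (PolyDeg k n).subtype

/-- The cohit space `(QP_k)_n`. -/
abbrev QP (k n : ℕ) : Type := PolyDeg k n ⧸ hitsDeg k n

/-- The class `[f]` in `(QP_k)_n` of a homogeneous polynomial `f` of degree `n`. -/
def QP.mk {k n : ℕ} (f : Poly k) (hf : f.IsHomogeneous n) : QP k n :=
  (hitsDeg k n).mkQ ⟨f, hf⟩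

/-- The map `(QP_k)_n → (QP_k)_m`, `[f] ↦ [φ f]`, induced by a linear map `φ` that carries
degree `n` to degree `m` and hit polynomials to hit polynomials. -/
def QP.map {k n m : ℕ} (φ : Poly k →ₗ[ZMod 2] Poly k)
    (hdeg : ∀ f ∈ PolyDeg k n, φ f ∈ PolyDeg k m) (hhit : ∀ f ∈ hits k, φ f ∈ hits k) :
    QP k n →ₗ[ZMod 2] QP k m :=
  (hitsDeg k n).mapQ (hitsDeg k m) (φ.restrict hdeg) fun f hf => hhit f hf

theorem mem_hits_of_Sq {k i : ℕ} (hi : 0 < i) (f : Poly k) : Sq k i f ∈ hits k :=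
  Submodule.mem_iSup_of_mem i (Submodule.mem_iSup_of_mem hi ⟨f, rfl⟩)

theorem map_mem_hits {k : ℕ} (φ : Poly k →ₗ[ZMod 2] Poly k)
    (h : ∀ i, 0 < i → ∀ f, φ (Sq k i f) ∈ hits k) : ∀ f ∈ hits k, φ f ∈ hits k := by
  have : hits k ≤ (hits k).comap φ := by
    refine iSup_le fun i => iSup_le fun hi => ?_
    rintro _ ⟨f, rfl⟩
    exact h i hi f
  exact this

/-! ### The actions of the general linear group and of the symmetric group -/

/-- The linear substitution `x_j ↦ ∑ i, A i j x_i`. -/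
def subst {k : ℕ} (A : Matrix (Fin k) (Fin k) (ZMod 2)) : Poly k →ₐ[ZMod 2] Poly k :=
  MvPolynomial.aeval fun j => ∑ i, MvPolynomial.C (A i j) * MvPolynomial.X i

theorem subst_one {k : ℕ} : subst (1 : Matrix (Fin k) (Fin k) (ZMod 2)) = AlgHom.id _ _ := by
  ext1 j
  simp [subst, Matrix.one_apply]

theorem subst_mul {k : ℕ} (A B : Matrix (Fin k) (Fin k) (ZMod 2)) :
    subst (A * B) = (subst A).comp (subst B) := by
  ext1 j
  simp only [subst, Matrix.mul_apply, MvPolynomial.aeval_X, AlgHom.comp_apply, map_sum, map_mul,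
    MvPolynomial.algHom_C, MvPolynomial.algebraMap_eq, Finset.sum_mul, Finset.mul_sum]
  rw [Finset.sum_comm]
  refine Finset.sum_congr rfl fun i _ => Finset.sum_congr rfl fun l _ => ?_
  ring

theorem subst_mem {k n : ℕ} (A : Matrix (Fin k) (Fin k) (ZMod 2)) :
    ∀ f ∈ PolyDeg k n, (subst A).toLinearMap f ∈ PolyDeg k n := by
  intro f hf
  have := MvPolynomial.IsHomogeneous.aeval (S := ZMod 2) hf
    (fun j => ∑ i, MvPolynomial.C (A i j) * MvPolynomial.X i) (n := 1)
    (fun j => MvPolynomial.IsHomogeneous.sum _ _ _ fun i _ =>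
      MvPolynomial.isHomogeneous_C_mul_X _ _)
  rw [one_mul] at this
  exact this

theorem sqTotal_subst {k : ℕ} (A : Matrix (Fin k) (Fin k) (ZMod 2)) :
    (sqTotal k).comp (subst A) = (Polynomial.mapAlgHom (subst A)).comp (sqTotal k) := by
  ext1 j
  have hc : ∀ c : ZMod 2, c ^ 2 = c := by decide
  simp only [subst, sqTotal, MvPolynomial.aeval_X, AlgHom.comp_apply, map_sum, map_mul, map_add,
    map_pow, MvPolynomial.algHom_C, Polynomial.coe_mapAlgHom, Polynomial.map_C,
    Polynomial.map_X, RingHom.coe_coe, Polynomial.algebraMap_apply, MvPolynomial.algebraMap_eq,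
    mul_add, Finset.sum_add_distrib]
  rw [CharTwo.sum_sq]
  simp only [mul_pow, ← map_pow, hc, Finset.sum_mul, mul_assoc]

theorem Sq_subst {k : ℕ} (A : Matrix (Fin k) (Fin k) (ZMod 2)) (i : ℕ) (f : Poly k) :
    subst A (Sq k i f) = Sq k i (subst A f) := by
  have := congrArg (fun p => Polynomial.coeff p i) (DFunLike.congr_fun (sqTotal_subst A) f)
  simpa [Sq] using this.symm

theorem subst_mem_hits {k : ℕ} (A : Matrix (Fin k) (Fin k) (ZMod 2)) :
    ∀ f ∈ hits k, (subst A).toLinearMap f ∈ hits k :=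
  map_mem_hits _ fun i hi f => by
    change subst A (Sq k i f) ∈ hits k
    rw [Sq_subst]
    exact mem_hits_of_Sq hi _

/-- The action of matrices on `(QP_k)_n` by linear substitution. -/
def matAction (k n : ℕ) :
    Matrix (Fin k) (Fin k) (ZMod 2) →* (QP k n →ₗ[ZMod 2] QP k n) where
  toFun A := QP.map (subst A).toLinearMap (subst_mem A) (subst_mem_hits A)
  map_one' := by
    refine Submodule.linearMap_qext _ (LinearMap.ext fun f => ?_)
    refine congrArg (hitsDeg k n).mkQ (Subtype.ext ?_)
    exact DFunLike.congr_fun subst_one (f : Poly k)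
  map_mul' A B := by
    refine Submodule.linearMap_qext _ (LinearMap.ext fun f => ?_)
    refine congrArg (hitsDeg k n).mkQ (Subtype.ext ?_)
    exact DFunLike.congr_fun (subst_mul A B) (f : Poly k)

/-- The representation of `GL_k(F_2)` on `(QP_k)_n`, induced by `g x_j = ∑ i, g i j x_i`. -/
def glRep (k n : ℕ) : Representation (ZMod 2) (GL (Fin k) (ZMod 2)) (QP k n) :=
  (matAction k n).comp (Units.coeHom _)

/-- The symmetric group `Σ_k` on the variables, as permutation matrices in `GL_k(F_2)`. -/
def permGL (k : ℕ) : Equiv.Perm (Fin k) →* GL (Fin k) (ZMod 2) :=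
  (Matrix.permMatrixHom (n := Fin k) (R := ZMod 2)).toHomUnits

/-- The representation of `Σ_k` on `(QP_k)_n`, induced by `σ x_j = x_{σ j}`. -/
def symRep (k n : ℕ) : Representation (ZMod 2) (Equiv.Perm (Fin k)) (QP k n) :=
  (glRep k n).comp (permGL k)

theorem subst_permGL {k : ℕ} (σ : Equiv.Perm (Fin k)) :
    subst (permGL k σ : Matrix (Fin k) (Fin k) (ZMod 2)) = MvPolynomial.rename σ := by
  have h : ∀ i j, (permGL k σ : Matrix (Fin k) (Fin k) (ZMod 2)) i j = if i = σ j then 1 else 0 := by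
    intro i j
    change Equiv.Perm.permMatrix (ZMod 2) σ⁻¹ i j = _
    simp only [Equiv.Perm.permMatrix, PEquiv.toMatrix_apply, Equiv.toPEquiv_apply,
      Option.mem_some_iff, Equiv.Perm.inv_eq_iff_eq]
  ext1 j
  simp [subst, h]

/-! ### The Kameko homomorphism -/

/-- The linear map `P_k → P_k` with `x^a ↦ x^((a - 1) / 2)` if all `a_j` are odd, and
`x^a ↦ 0` otherwise. -/
def kamekoPoly (k : ℕ) : Poly k →ₗ[ZMod 2] Poly k :=
  (MvPolynomial.basisMonomials (Fin k) (ZMod 2)).constr (ZMod 2) fun a =>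
    if ∀ j, Odd (a j) then
      MvPolynomial.monomial (a.mapRange (fun e => (e - 1) / 2) rfl) 1
    else 0

theorem kamekoPoly_monomial {k : ℕ} (a : Fin k →₀ ℕ) :
    kamekoPoly k (MvPolynomial.monomial a 1) =
      if ∀ j, Odd (a j) then
        MvPolynomial.monomial (a.mapRange (fun e => (e - 1) / 2) rfl) 1
      else 0 := by
  have := (MvPolynomial.basisMonomials (Fin k) (ZMod 2)).constr_basis (ZMod 2) (fun a =>
    if ∀ j, Odd (a j) then
      (MvPolynomial.monomial (a.mapRange (fun e => (e - 1) / 2) rfl) 1 : Poly k)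
    else 0) a
  simpa [kamekoPoly] using this

theorem kamekoPoly_mem {k n m : ℕ} (h : n = 2 * m + k) :
    ∀ f ∈ PolyDeg k n, kamekoPoly k f ∈ PolyDeg k m := by
  intro f hf
  rw [f.as_sum, map_sum]
  refine Submodule.sum_mem _ fun a ha => ?_
  have hdeg := hf.degree_eq_sum_deg_support ha
  rw [← mul_one (MvPolynomial.coeff a f), ← smul_eq_mul, ← MvPolynomial.smul_monomial, map_smul,
    kamekoPoly_monomial]
  refine Submodule.smul_mem _ _ ?_
  split_ifs with hodd
  · refine MvPolynomial.isHomogeneous_monomial _ ?_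
    have h1 : ∑ j, a j = n := by
      rw [hdeg]
      exact (Finset.sum_subset (Finset.subset_univ _) fun j _ hj => by simpa using hj).symm
    have h2 : ∑ j, a j = ∑ j, (2 * ((a j - 1) / 2) + 1) :=
      Finset.sum_congr rfl fun j _ => by have := hodd j; grind
    rw [Finset.sum_add_distrib, ← Finset.mul_sum] at h2
    simp only [Finsupp.degree_eq_sum, Finsupp.mapRange_apply]
    simp at h2
    omega
  · exact Submodule.zero_mem _

/-- The map `K` above satisfies `K (f g^2) = K f * g`. -/
theorem kamekoPoly_mul_sq {k : ℕ} (f g : Poly k) :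
    kamekoPoly k (f * g ^ 2) = kamekoPoly k f * g := by
  have mono : ∀ a b : Fin k →₀ ℕ,
      kamekoPoly k (MvPolynomial.monomial a 1 * MvPolynomial.monomial b 1 ^ 2) =
        kamekoPoly k (MvPolynomial.monomial a 1) * MvPolynomial.monomial b 1 := by
    intro a b
    rw [MvPolynomial.monomial_pow, MvPolynomial.monomial_mul, one_pow, one_mul,
      kamekoPoly_monomial, kamekoPoly_monomial]
    have hiff : (∀ j, Odd ((a + 2 • b) j)) ↔ ∀ j, Odd (a j) :=
      forall_congr' fun j => by simp [Nat.odd_add]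
    by_cases ha : ∀ j, Odd (a j)
    · rw [if_pos ha, if_pos (hiff.2 ha), MvPolynomial.monomial_mul, one_mul]
      refine congrArg (fun e => MvPolynomial.monomial e (1 : ZMod 2)) (Finsupp.ext fun j => ?_)
      have := ha j
      simp
      grind
    · rw [if_neg ha, if_neg (fun h => ha (hiff.1 h)), zero_mul]
  have hc : ∀ c : ZMod 2, c ^ 2 = c := by decide
  have hmon : ∀ (a : Fin k →₀ ℕ) (c : ZMod 2),
      (MvPolynomial.monomial a c : Poly k) = c • MvPolynomial.monomial a 1 := by
    intro a c
    rw [MvPolynomial.smul_monomial, smul_eq_mul, mul_one]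
  induction g using MvPolynomial.induction_on' with
  | monomial b d =>
    rw [hmon b d, smul_pow, hc, mul_smul_comm, mul_smul_comm, map_smul]
    congr 1
    induction f using MvPolynomial.induction_on' with
    | monomial a c => rw [hmon a c, smul_mul_assoc, map_smul, map_smul, smul_mul_assoc, mono]
    | add p q hp hq => rw [add_mul, map_add, map_add, add_mul, hp, hq]
  | add p q hp hq => rw [CharTwo.add_sq, mul_add, map_add, hp, hq, mul_add]

/-- `K` vanishes on the positive squares of a product of distinct variables. -/
theorem kamekoPoly_Sq_prod {k i : ℕ} (hi : 0 < i) (E : Finset (Fin k)) :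
    kamekoPoly k (Sq k i (∏ j ∈ E, MvPolynomial.X j)) = 0 := by
  have h1 : Sq k i (∏ j ∈ E, MvPolynomial.X j) =
      ∑ s ∈ E.powerset, if i = (E \ s).card then
        (∏ j ∈ s, MvPolynomial.X j) * (∏ j ∈ E \ s, MvPolynomial.X j) ^ 2 else 0 := by
    change Polynomial.coeff (sqTotal k _) i = _
    rw [map_prod]
    simp only [sqTotal, MvPolynomial.aeval_X]
    rw [Finset.prod_add, Polynomial.finsetSum_coeff]
    refine Finset.sum_congr rfl fun s _ => ?_
    rw [Finset.prod_mul_distrib, Finset.prod_const, ← mul_assoc, ← map_prod, ← map_prod,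
      ← map_mul, Polynomial.coeff_C_mul_X_pow, Finset.prod_pow]
  rw [h1, map_sum]
  refine Finset.sum_eq_zero fun s hs => ?_
  split_ifs with his
  · rw [kamekoPoly_mul_sq]
    have h2 : (∏ j ∈ s, MvPolynomial.X j : Poly k) =
        MvPolynomial.monomial (∑ j ∈ s, Finsupp.single j 1) 1 := by
      rw [MvPolynomial.monomial_sum_one]
      rfl
    have hne : (E \ s).Nonempty := Finset.card_pos.1 (his ▸ hi)
    obtain ⟨j, hj⟩ := hne
    rw [Finset.mem_sdiff] at hj
    rw [h2, kamekoPoly_monomial, if_neg, zero_mul]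
    intro h
    have := h j
    rw [Finsupp.finsetSum_apply, Finset.sum_eq_zero] at this
    · simp at this
    · intro l hl
      rw [Finsupp.single_apply, if_neg]
      rintro rfl
      exact hj.2 hl
  · exact map_zero _

theorem kamekoPoly_Sq_mem_hits {k : ℕ} (i : ℕ) (hi : 0 < i) (f : Poly k) :
    kamekoPoly k (Sq k i f) ∈ hits k := by
  induction f using MvPolynomial.induction_on' with
  | add p q hp hq =>
    rw [map_add, map_add]
    exact Submodule.add_mem _ hp hq
  | monomial a c =>
    have hmon : (MvPolynomial.monomial a c : Poly k) = c • MvPolynomial.monomial a 1 := by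
      rw [MvPolynomial.smul_monomial, smul_eq_mul, mul_one]
    rw [hmon, map_smul, map_smul]
    refine Submodule.smul_mem _ _ ?_
    set E : Finset (Fin k) := Finset.univ.filter fun j => Odd (a j) with hE
    set g : Poly k := MvPolynomial.monomial (a.mapRange (fun e => e / 2) rfl) 1 with hg
    have hfact : (MvPolynomial.monomial a 1 : Poly k) = (∏ j ∈ E, MvPolynomial.X j) * g ^ 2 := by
      have h2 : (∏ j ∈ E, MvPolynomial.X j : Poly k) =
          MvPolynomial.monomial (∑ j ∈ E, Finsupp.single j 1) 1 := by
        rw [MvPolynomial.monomial_sum_one]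
        rfl
      rw [h2, hg, MvPolynomial.monomial_pow, MvPolynomial.monomial_mul, one_pow, one_mul]
      refine congrArg (fun e => MvPolynomial.monomial e (1 : ZMod 2)) (Finsupp.ext fun j => ?_)
      simp only [hE, Finsupp.add_apply, Finsupp.smul_apply, Finsupp.mapRange_apply,
        Finsupp.finsetSum_apply, Finsupp.single_apply, Finset.sum_ite_eq', Finset.mem_filter,
        Finset.mem_univ, true_and, smul_eq_mul]
      split_ifs with h <;> grind
    have hsq : sqTotal k g ^ 2 =
        Polynomial.expand (Poly k) 2 ((sqTotal k g).map (frobenius (Poly k) 2)) := by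
      rw [← Polynomial.map_expand, Polynomial.map_frobenius_expand]
    have hcoeff : Sq k i (MvPolynomial.monomial a 1) =
        ∑ x ∈ Finset.HasAntidiagonal.antidiagonal i, if 2 ∣ x.2 then
          Sq k x.1 (∏ j ∈ E, MvPolynomial.X j) * Sq k (x.2 / 2) g ^ 2 else 0 := by
      change Polynomial.coeff (sqTotal k _) i = _
      rw [hfact, map_mul, map_pow, hsq, Polynomial.coeff_mul]
      refine Finset.sum_congr rfl fun x _ => ?_
      rw [Polynomial.coeff_expand (by norm_num)]
      split_ifs
      · rw [Polynomial.coeff_map]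
        rfl
      · rw [mul_zero]
    rw [hcoeff, map_sum]
    refine Submodule.sum_mem _ fun x hx => ?_
    split_ifs with hdvd
    · rw [kamekoPoly_mul_sq]
      rcases Nat.eq_zero_or_pos x.1 with h0 | hpos
      · have hx2 : 0 < x.2 / 2 := by
          have := Finset.HasAntidiagonal.mem_antidiagonal.1 hx
          omega
        have hS0 : Sq k 0 (∏ j ∈ E, MvPolynomial.X j) = ∏ j ∈ E, MvPolynomial.X j := by
          change Polynomial.coeff (sqTotal k _) 0 = _
          rw [map_prod, Polynomial.coeff_zero_prod]
          refine Finset.prod_congr rfl fun j _ => ?_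
          simp [sqTotal]
        have h2 : (∏ j ∈ E, MvPolynomial.X j : Poly k) =
            MvPolynomial.monomial (∑ j ∈ E, Finsupp.single j 1) 1 := by
          rw [MvPolynomial.monomial_sum_one]
          rfl
        rw [h0, hS0, h2, kamekoPoly_monomial]
        split_ifs with hodd
        · have hz : (∑ j ∈ E, Finsupp.single j 1 : Fin k →₀ ℕ).mapRange
              (fun e => (e - 1) / 2) rfl = 0 := by
            ext j
            simp only [Finsupp.mapRange_apply, Finsupp.finsetSum_apply, Finsupp.single_apply,
              Finset.sum_ite_eq', Finsupp.coe_zero, Pi.zero_apply]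
            split_ifs <;> simp
          rw [hz, ← MvPolynomial.C_apply, map_one, one_mul]
          exact mem_hits_of_Sq hx2 g
        · rw [zero_mul]
          exact Submodule.zero_mem _
      · rw [kamekoPoly_Sq_prod hpos, zero_mul]
        exact Submodule.zero_mem _
    · rw [map_zero]
      exact Submodule.zero_mem _

/-- The Kameko homomorphism `(QP_k)_n → (QP_k)_m`, where `m = (n - k) / 2` and `n - k` is even. -/
def kameko (k n m : ℕ) (h : n = 2 * m + k) : QP k n →ₗ[ZMod 2] QP k m :=
  QP.map (kamekoPoly k) (kamekoPoly_mem h) (map_mem_hits _ kamekoPoly_Sq_mem_hits)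

/-! ### The polynomials in four variables -/

/-- The homomorphism `ψ(u) = x_1 ... x_k u^2`. -/
def psi (k : ℕ) : Poly k →ₗ[ZMod 2] Poly k where
  toFun u := (∏ j, MvPolynomial.X j) * u ^ 2
  map_add' u v := by rw [CharTwo.add_sq, mul_add]
  map_smul' c u := by
    have hc : ∀ c : ZMod 2, c ^ 2 = c := by decide
    rw [smul_pow, hc, mul_smul_comm, RingHom.id_apply]

/-- The monomial `x_1^a x_2^b x_3^c x_4^d`. -/
def mono (a b c d : ℕ) : Poly 4 :=
  MvPolynomial.X 0 ^ a * MvPolynomial.X 1 ^ b * MvPolynomial.X 2 ^ c * MvPolynomial.X 3 ^ d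

theorem mono_isHomogeneous {a b c d n : ℕ} (h : a + b + c + d = n) :
    (mono a b c d).IsHomogeneous n := by
  rw [← h]
  exact (((MvPolynomial.isHomogeneous_X_pow _ _).mul (MvPolynomial.isHomogeneous_X_pow _ _)).mul
    (MvPolynomial.isHomogeneous_X_pow _ _)).mul (MvPolynomial.isHomogeneous_X_pow _ _)

/-- `x_1 x_2 x_3^6 x_4^6 + x_1^3 x_2^3 x_3^4 x_4^4`. -/
def gen14 : Poly 4 := mono 1 1 6 6 + mono 3 3 4 4

theorem gen14_isHomogeneous : gen14.IsHomogeneous 14 :=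
  (mono_isHomogeneous rfl).add (mono_isHomogeneous rfl)

/-- The polynomials `Sigma_4[1], ..., Sigma_4[11]`; `Sigma_4[j + 1]` is `sigma4 j`. -/
def sigma4 : Fin 11 → Poly 4 := ![
  mono 1 2 1 28 + mono 1 2 28 1 + mono 1 2 4 25 + mono 1 2 5 24 + mono 1 3 4 24 +
    mono 3 1 4 24,
  mono 1 2 29 0 + mono 1 2 0 29 + mono 1 3 28 0 + mono 1 3 0 28 + mono 1 30 1 0 +
    mono 1 30 0 1 + mono 1 0 2 29 + mono 1 0 3 28 + mono 1 0 30 1 + mono 3 1 28 0 +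
    mono 3 1 0 28 + mono 3 0 1 28 + mono 0 1 2 29 + mono 0 1 3 28 + mono 0 1 30 1 +
    mono 0 3 1 28,
  mono 1 1 15 15 + mono 1 15 1 15 + mono 1 15 15 1 + mono 15 1 1 15 + mono 15 1 15 1 +
    mono 15 15 1 1,
  mono 1 15 3 13 + mono 1 3 13 15 + mono 1 3 15 13 + mono 15 1 3 13 + mono 15 3 1 13 +
    mono 15 3 13 1 + mono 3 1 13 15 + mono 3 1 15 13 + mono 3 13 1 15 + mono 3 13 15 1 +
    mono 3 15 1 13 + mono 3 15 13 1,
  mono 15 3 5 9 + mono 3 15 5 9 + mono 3 5 15 9 + mono 3 5 9 15,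
  mono 15 3 7 7 + mono 15 7 3 7 + mono 15 7 7 3 + mono 3 15 7 7 + mono 3 7 15 7 +
    mono 3 7 7 15 + mono 7 15 3 7 + mono 7 15 7 3 + mono 7 3 15 7 + mono 7 3 7 15 +
    mono 7 7 15 3 + mono 7 7 3 15,
  mono 1 1 2 28 + mono 1 2 4 25 + mono 1 2 5 24 + mono 1 3 4 24 + mono 3 1 4 24,
  mono 3 29 0 0 + mono 3 0 29 0 + mono 3 0 0 29 + mono 0 3 29 0 + mono 0 3 0 29 +
    mono 0 0 3 29,
  mono 1 31 0 0 + mono 1 0 31 0 + mono 1 0 0 31 + mono 31 1 0 0 + mono 31 0 1 0 +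
    mono 31 0 0 1 + mono 0 1 31 0 + mono 0 1 0 31 + mono 0 31 1 0 + mono 0 31 0 1 +
    mono 0 0 1 31 + mono 0 0 31 1,
  mono 1 7 11 13 + mono 7 1 11 13 + mono 7 11 1 13 + mono 7 11 13 1,
  mono 3 3 13 13 + mono 7 7 9 9]

theorem sigma4_isHomogeneous (j : Fin 11) : (sigma4 j).IsHomogeneous 32 := by
  fin_cases j <;>
    simp only [sigma4, Fin.reduceFinMk, Matrix.cons_val] <;>
    repeat' first
      | with_reducible refine MvPolynomial.IsHomogeneous.add ?_ ?_
      | exact mono_isHomogeneous rfl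

end

end HitProblem

open HitProblem

/-! Everything is finite linear algebra over F_2 once each of the two cohit spaces has monomials
that span it and functionals, vanishing on hit polynomials, that separate those monomials.

Spanning. Let V be the sum of the hit polynomials and the span of the chosen monomials. If all terms
but one of a Steenrod square of a monomial (or of a sum of such squares) lie in V, so does the
remaining one. Applied in a suitable order, this puts every monomial of the degree into V. The order
is given as data, and `Known.learn` shows that each step is sound whatever the data, so
`polyDeg_le_of_learnAll` needs only one evaluation.

Independence. In degree 14 there are explicit functionals, tested on all squares of monomials. In
degree 32 two families suffice. One consists of the 50 functionals of degree 14 composed with the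
Kameko homomorphism, which preserves hits. The other consists of the 64 functionals sending f to the
value of a partial derivative of f at a point of F_2^4. Derivatives commute with Steenrod squares
(`pderiv_Sq`). At an F_2-point, Sq^i multiplies the value of a form of degree d by the binomial
coefficient (d choose i) (`eval_Sq_expoMono`). Here d = 31 - i has the binary digits complementary
to those of i, so this coefficient is even. Together the two families have rank 95. Those of the
first family vanish on the kernel of the Kameko homomorphism, so the derivatives separate that
kernel, which has dimension 95 - 50 = 45.

Invariants. The functionals embed the cohit space in bit vectors (`CohitBasis.code_injective`), so a
class is fixed by a generator exactly when its defect, the code of its image plus its own code, is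
zero. If the defects of all basis monomials but the first r are independent, an invariant is
determined by its first r coordinates, and the invariants have dimension at most r
(`CohitBasis.finrank_le`). The listed classes are invariant and independent, so they give the
matching lower bound (`CohitBasis.eq_span_of_fixed`).

The Kameko homomorphism K. From K(f g^2) = K(f) g it follows that ψ is a section of K on
polynomials, which gives surjectivity. It also shows that the generator of the invariants in degree
32 maps to the nonzero generator in degree 14, so no nonzero invariant lies in the kernel. -/

namespace HitProblem

/-! ### Monomials in four variables and their Steenrod squares -/

/-- Exponents `(a, b, c, d)` of the monomials `x_1^a x_2^b x_3^c x_4^d`. -/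
abbrev Expo : Type := ℕ × ℕ × ℕ × ℕ

/-- The total degree of an exponent. -/
def Expo.deg : Expo → ℕ
  | (a, b, c, d) => a + b + c + d

/-- The monomial with a given exponent. -/
noncomputable def expoMono : Expo → Poly 4
  | (a, b, c, d) => mono a b c d

/-- The sum of the monomials whose exponents are listed. -/
noncomputable def listPoly (l : List Expo) : Poly 4 := (l.map expoMono).sum

/-- The numbers `t < 2 ^ k` whose binary digits are among those of `m`. -/
def submasks : ℕ → ℕ → List ℕ
  | 0, _ => [0]
  | k + 1, m =>
    if m % 2 = 1 then (submasks k (m / 2)).flatMap fun t => [2 * t, 2 * t + 1]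
    else (submasks k (m / 2)).map fun t => 2 * t

/-- The exponents of the terms of `Sq^i` of a monomial. -/
def sqTerms (i : ℕ) : Expo → List Expo
  | (a, b, c, d) =>
    (submasks (i.log2 + 1) a).flatMap fun s => if s ≤ i then
      (submasks (i.log2 + 1) b).flatMap fun t => if t ≤ i - s then
        (submasks (i.log2 + 1) c).flatMap fun u => if u ≤ i - s - t then
          if (i - s - t - u) &&& d = i - s - t - u then
            [(a + s, b + t, c + u, d + (i - s - t - u))] else []
        else []
      else []
    else []

/-! ### Sums over lists, and binary expansions of powers in characteristic two -/

theorem sum_map_flatMap {α β A : Type*} [AddMonoid A] (l : List α) (f : α → List β) (g : β → A) :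
    ((l.flatMap f).map g).sum = (l.map fun x => ((f x).map g).sum).sum := by
  induction l with
  | nil => rfl
  | cons x l ih => simp [ih]

theorem mul_sum_map {α A : Type*} [NonUnitalNonAssocSemiring A] (r : A) (l : List α) (f : α → A) :
    r * (l.map f).sum = (l.map fun x => r * f x).sum := by
  induction l with
  | nil => simp
  | cons x l ih => simp [ih, mul_add]

theorem sum_map_mul {α A : Type*} [NonUnitalNonAssocSemiring A] (r : A) (l : List α) (f : α → A) :
    (l.map f).sum * r = (l.map fun x => f x * r).sum := by
  induction l with
  | nil => simp
  | cons x l ih => simp [ih, add_mul]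

theorem map_list_sum_map {α A B F : Type*} [AddMonoid A] [AddMonoid B] [FunLike F A B]
    [AddMonoidHomClass F A B] (φ : F) (l : List α) (f : α → A) :
    φ (l.map f).sum = (l.map fun x => φ (f x)).sum := by
  induction l with
  | nil => simp
  | cons x l ih => simp [ih]

/-- In characteristic two, `(1 + y) ^ m` is the sum of the `y ^ t` with `t` a submask of `m`. -/
theorem one_add_pow_eq_submasks {R : Type*} [CommRing R] [CharP R 2] (k : ℕ) (y : R) (m : ℕ) :
    (1 + y) ^ m = ((submasks k m).map fun t => y ^ t).sum * (1 + y ^ 2 ^ k) ^ (m / 2 ^ k) := by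
  induction k generalizing y m with
  | zero => simp [submasks]
  | succ k ih =>
    -- The last binary digit of the exponent is split off: (1 + y)^(2q) = (1 + y^2)^q in
    -- characteristic two, and the induction hypothesis applies to y^2.
    have hq : (1 + y) ^ (2 * (m / 2)) =
        ((submasks k (m / 2)).map fun t => y ^ (2 * t)).sum *
          (1 + y ^ 2 ^ (k + 1)) ^ (m / 2 ^ (k + 1)) := by
      rw [pow_mul, CharTwo.add_sq, one_pow, ih (y ^ 2) (m / 2), Nat.div_div_eq_div_mul, ← pow_mul,
        ← pow_succ']
      simp only [← pow_mul]
    rcases Nat.mod_two_eq_zero_or_one m with h | h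
    · have hm : m = 2 * (m / 2) := by omega
      rw [submasks, if_neg (by omega), List.map_map]
      nth_rewrite 1 [hm]
      exact hq
    · have hm : m = 2 * (m / 2) + 1 := by omega
      rw [submasks, if_pos h, sum_map_flatMap]
      nth_rewrite 1 [hm]
      rw [pow_succ, hq, mul_right_comm]
      congr 1
      rw [sum_map_mul]
      congr 2
      funext t
      simp [pow_succ]
      ring

/-- The factor neglected by the first k binary digits is a power of 1 + (xT)^(2^k), hence 1 modulo
T^(2^k). Coefficients below 2^k therefore depend on k digits of the exponent only. -/
theorem X_pow_dvd_one_add_pow_sub {R : Type*} [CommRing R] [CharP R 2] (k : ℕ) (x : R) (m : ℕ) :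
    (Polynomial.X : Polynomial R) ^ 2 ^ k ∣ (1 + Polynomial.C x * Polynomial.X) ^ m -
      ((submasks k m).map fun t => (Polynomial.C x * Polynomial.X) ^ t).sum := by
  rw [one_add_pow_eq_submasks k, ← mul_sub_one]
  refine Dvd.dvd.mul_left ?_ _
  have h := sub_dvd_pow_sub_pow (1 + (Polynomial.C x * Polynomial.X) ^ 2 ^ k : Polynomial R) 1
    (m / 2 ^ k)
  rw [one_pow, add_sub_cancel_left] at h
  refine Dvd.dvd.trans ?_ h
  rw [mul_pow]
  exact Dvd.intro_left _ rfl

/-- Since x + x^2 T = x (1 + xT), the factor of one variable contributes x^(m + t) T^t for each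
submask t. This peels one variable off the total square of a monomial, with the other variables in
q. -/
theorem coeff_add_sq_pow_mul {R : Type*} [CommRing R] [CharP R 2] {i k : ℕ} (hi : i < 2 ^ k)
    (x : R) (m : ℕ) (q : Polynomial R) :
    (((Polynomial.C x + Polynomial.C (x ^ 2) * Polynomial.X) ^ m * q).coeff i) =
      ((submasks k m).map fun t => if t ≤ i then x ^ (m + t) * q.coeff (i - t) else 0).sum := by
  have h1 : (Polynomial.C x + Polynomial.C (x ^ 2) * Polynomial.X : Polynomial R) ^ m =
      Polynomial.C (x ^ m) * (1 + Polynomial.C x * Polynomial.X) ^ m := by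
    rw [map_pow Polynomial.C x m, ← mul_pow]
    congr 1
    rw [mul_add, mul_one, ← mul_assoc, ← Polynomial.C_mul, sq]
  obtain ⟨r, hr⟩ := X_pow_dvd_one_add_pow_sub k x m
  have h2 : (Polynomial.C x + Polynomial.C (x ^ 2) * Polynomial.X : Polynomial R) ^ m * q =
      Polynomial.X ^ 2 ^ k * (Polynomial.C (x ^ m) * r * q) +
        ((submasks k m).map fun t =>
          Polynomial.C (x ^ (m + t)) * q * Polynomial.X ^ t).sum := by
    have h3 : ((submasks k m).map fun t =>
          Polynomial.C (x ^ (m + t)) * q * Polynomial.X ^ t).sum = Polynomial.C (x ^ m) *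
          ((submasks k m).map fun t => (Polynomial.C x * Polynomial.X) ^ t).sum * q := by
      rw [mul_sum_map, sum_map_mul]
      refine congrArg List.sum (List.map_congr_left fun t _ => ?_)
      rw [pow_add x m t, map_mul, map_pow Polynomial.C x t, mul_pow]
      ring
    rw [h1, sub_eq_iff_eq_add.1 hr, h3]
    ring
  rw [h2, Polynomial.coeff_add, Polynomial.coeff_X_pow_mul', if_neg (not_le.2 hi), zero_add,
    ← Polynomial.lcoeff_apply, map_list_sum_map]
  refine congrArg List.sum (List.map_congr_left fun t _ => ?_)
  rw [Polynomial.lcoeff_apply, Polynomial.coeff_mul_X_pow']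
  split_ifs
  · rw [Polynomial.coeff_C_mul]
  · rfl

theorem land_eq_left_iff (r m : ℕ) :
    r &&& m = r ↔ (r / 2 &&& m / 2 = r / 2) ∧ (r % 2 = 1 → m % 2 = 1) := by
  have h1 : (r &&& m) / 2 = r / 2 &&& m / 2 := Nat.and_div_two
  have h2 : (r &&& m) % 2 = 1 ↔ r % 2 = 1 ∧ m % 2 = 1 := Nat.and_mod_two_eq_one
  rw [← h1]
  omega

/-- Each submask is listed exactly once, so a sum that only sees t = r reduces to a bit test. This
is what replaces the enumeration for the last variable in `sqTerms`. -/
theorem sum_submasks_ite {A : Type*} [AddMonoid A] {k r : ℕ} (hr : r < 2 ^ k) (m : ℕ) (y : A) :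
    ((submasks k m).map fun t => if t = r then y else 0).sum = if r &&& m = r then y else 0 := by
  induction k generalizing r m with
  | zero =>
    have : r = 0 := by simpa using hr
    simp [submasks, this]
  | succ k ih =>
    have ih := ih (r := r / 2) (by rw [pow_succ] at hr; omega) (m / 2)
    rw [submasks, if_congr (land_eq_left_iff r m) rfl rfl]
    by_cases hm : m % 2 = 1
    · have hc : (r / 2 &&& m / 2 = r / 2 ∧ (r % 2 = 1 → m % 2 = 1)) ↔ r / 2 &&& m / 2 = r / 2 :=
        and_iff_left fun _ => hm
      rw [if_pos hm, sum_map_flatMap, if_congr hc rfl rfl, ← ih]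
      refine congrArg List.sum (List.map_congr_left fun t _ => ?_)
      simp only [List.map_cons, List.map_nil, List.sum_cons, List.sum_nil, add_zero]
      by_cases ht : t = r / 2
      · rcases Nat.mod_two_eq_zero_or_one r with h0 | h0
        · rw [if_pos ht, if_pos (by omega), if_neg (by omega), add_zero]
        · rw [if_pos ht, if_neg (by omega), if_pos (by omega), zero_add]
      · rw [if_neg ht, if_neg (by omega), if_neg (by omega), add_zero]
    · rw [if_neg hm, List.map_map]
      by_cases h0 : r % 2 = 1
      · rw [if_neg fun h => hm (h.2 h0)]
        refine List.sum_eq_zero fun x hx => ?_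
        obtain ⟨t, -, rfl⟩ := List.mem_map.1 hx
        exact if_neg (show ¬2 * t = r by omega)
      · rw [if_congr (and_iff_left fun h => absurd h h0) rfl rfl, ← ih]
        refine congrArg List.sum (List.map_congr_left fun t _ => ?_)
        exact if_congr (show 2 * t = r ↔ t = r / 2 by omega) rfl rfl

/-- The Cartan formula with Lucas' theorem: i is shared out among the four variables, each share
being a submask of the exponent there. The fourth share is forced by the other three. -/
theorem Sq_expoMono (i : ℕ) (e : Expo) : Sq 4 i (expoMono e) = listPoly (sqTerms i e) := by
  obtain ⟨a, b, c, d⟩ := e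
  -- No share exceeds i, so this many binary digits suffice for every variable.
  have hi : i < 2 ^ (i.log2 + 1) := Nat.lt_log2_self
  have h1 : Sq 4 i (expoMono (a, b, c, d)) = Polynomial.coeff
      ((Polynomial.C (MvPolynomial.X 0) + Polynomial.C (MvPolynomial.X 0 ^ 2) * Polynomial.X) ^ a *
      ((Polynomial.C (MvPolynomial.X 1) + Polynomial.C (MvPolynomial.X 1 ^ 2) * Polynomial.X) ^ b *
      ((Polynomial.C (MvPolynomial.X 2) + Polynomial.C (MvPolynomial.X 2 ^ 2) * Polynomial.X) ^ c *
      ((Polynomial.C (MvPolynomial.X 3) + Polynomial.C (MvPolynomial.X 3 ^ 2) * Polynomial.X) ^ d *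
        1)))) i := by
    change Polynomial.coeff (sqTotal 4 _) i = _
    simp only [expoMono, mono, map_mul, map_pow, sqTotal, MvPolynomial.aeval_X, mul_one, mul_assoc]
  rw [h1, coeff_add_sq_pow_mul hi, listPoly, sqTerms, sum_map_flatMap]
  congr 2
  funext s
  split_ifs with hs
  swap
  · simp
  rw [coeff_add_sq_pow_mul (k := i.log2 + 1) (by omega), sum_map_flatMap, mul_sum_map]
  congr 2
  funext t
  split_ifs with ht
  swap
  · simp
  rw [coeff_add_sq_pow_mul (k := i.log2 + 1) (by omega), sum_map_flatMap, mul_sum_map, mul_sum_map]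
  congr 2
  funext u
  by_cases hu : u ≤ i - s - t
  swap
  · simp [if_neg hu]
  rw [if_pos hu, if_pos hu]
  -- The polynomial left after the fourth variable is 1, whose only nonzero coefficient is in degree
  -- 0. So only the share that uses up the rest of i survives.
  have hv : ∀ v, (if v ≤ i - s - t - u then MvPolynomial.X 3 ^ (d + v) *
      Polynomial.coeff 1 (i - s - t - u - v) else 0 : Poly 4) =
      if v = i - s - t - u then MvPolynomial.X 3 ^ (d + (i - s - t - u)) else 0 := by
    intro v
    rw [Polynomial.coeff_one]
    by_cases hv : v = i - s - t - u
    · rw [if_pos hv.le, if_pos (by omega), if_pos hv, mul_one, hv]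
    · rw [if_neg hv]
      split_ifs with h2 h3
      · omega
      · exact mul_zero _
      · rfl
  rw [coeff_add_sq_pow_mul (k := i.log2 + 1) (by omega)]
  simp only [hv]
  rw [sum_submasks_ite (by omega)]
  split_ifs with h
  · simp only [List.map_cons, List.map_nil, List.sum_cons, List.sum_nil, expoMono, mono]
    ring
  · simp only [List.map_nil, List.sum_nil, mul_zero]

/-! ### Spanning sets of cohit spaces, found by elimination -/

theorem monomial_eq_expoMono (s : Fin 4 →₀ ℕ) :
    (MvPolynomial.monomial s 1 : Poly 4) = expoMono (s 0, s 1, s 2, s 3) := by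
  rw [MvPolynomial.monomial_eq, Finsupp.prod_fintype _ _ fun _ => pow_zero _, Fin.prod_univ_four]
  simp [expoMono, mono]

theorem expoMono_eq_monomial (e : Expo) : expoMono e = MvPolynomial.monomial
    (Finsupp.equivFunOnFinite.symm ![e.1, e.2.1, e.2.2.1, e.2.2.2]) 1 := by
  rw [monomial_eq_expoMono]
  rfl

/-- Homogeneity forces every monomial in the support to have degree n, so finitely many exponents
have to be treated. -/
theorem mem_span_expoMono {n : ℕ} {f : Poly 4} (hf : f ∈ PolyDeg 4 n) :
    f ∈ Submodule.span (ZMod 2) (expoMono '' {e | e.deg = n}) := by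
  rw [f.as_sum]
  refine Submodule.sum_mem _ fun s hs => ?_
  rw [← mul_one (MvPolynomial.coeff s f), ← smul_eq_mul, ← MvPolynomial.smul_monomial,
    monomial_eq_expoMono]
  refine Submodule.smul_mem _ _ (Submodule.subset_span ⟨_, ?_, rfl⟩)
  have h := hf (MvPolynomial.mem_support_iff.1 hs)
  change s 0 + s 1 + s 2 + s 3 = n
  rw [← h, Finsupp.weight_apply, Finsupp.sum_fintype _ _ (by simp),
    Fin.sum_univ_four]
  simp

theorem expoMono_isHomogeneous {n : ℕ} {e : Expo} (h : e.deg = n) : (expoMono e).IsHomogeneous n :=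
  mono_isHomogeneous h

theorem expoMono_mem {n : ℕ} {e : Expo} (h : e.deg = n) : expoMono e ∈ PolyDeg 4 n :=
  mono_isHomogeneous h

theorem listPoly_cons (e : Expo) (l : List Expo) :
    listPoly (e :: l) = expoMono e + listPoly l := by
  simp [listPoly]

theorem listPoly_filter_add (p : Expo → Bool) (l : List Expo) :
    listPoly (l.filter p) + listPoly (l.filter fun e => !p e) = listPoly l := by
  induction l with
  | nil => simp [listPoly]
  | cons e l ih =>
    cases h : p e
    · simp only [List.filter_cons, h, Bool.not_false, if_true, listPoly_cons, ← ih]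
      simp [add_left_comm]
    · simp only [List.filter_cons, h, if_true, listPoly_cons, ← ih]
      simp [add_assoc]

theorem listPoly_mem {V : Submodule (ZMod 2) (Poly 4)} {l : List Expo}
    (h : ∀ e ∈ l, expoMono e ∈ V) : listPoly l ∈ V :=
  list_sum_mem fun f hf => by
    obtain ⟨e, he, rfl⟩ := List.mem_map.1 hf
    exact h e he

theorem deg_of_mem_sqTerms {i : ℕ} {e f : Expo} (h : f ∈ sqTerms i e) : f.deg = e.deg + i := by
  obtain ⟨a, b, c, d⟩ := e
  simp only [sqTerms, List.mem_flatMap] at h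
  obtain ⟨s, -, h⟩ := h
  split_ifs at h with hs
  swap
  · simp at h
  obtain ⟨t, -, h⟩ := List.mem_flatMap.1 h
  split_ifs at h with ht
  swap
  · simp at h
  obtain ⟨u, -, h⟩ := List.mem_flatMap.1 h
  split_ifs at h with hu hv
  rotate_left
  · simp at h
  · simp at h
  rw [List.mem_singleton] at h
  subst h
  simp only [Expo.deg]
  omega

/-- The exponents of degree `n`. -/
def exposOfDeg (n : ℕ) : List Expo :=
  (List.range (n + 1)).flatMap fun s => (List.range (s + 1)).flatMap fun t =>
    (List.range (t + 1)).map fun d => (n - s, s - t, t - d, d)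

theorem mem_exposOfDeg {n : ℕ} {e : Expo} (h : e.deg = n) : e ∈ exposOfDeg n := by
  obtain ⟨a, b, c, d⟩ := e
  simp only [Expo.deg] at h
  simp only [exposOfDeg, List.mem_flatMap, List.mem_map, List.mem_range]
  exact ⟨b + c + d, by omega, c + d, by omega, d, by omega, by simp; omega⟩

/-- The position of an exponent in the list of those of the same degree. -/
def rank : Expo → ℕ
  | (_, b, c, d) =>
    d + (c + d) * (c + d + 1) / 2 + (b + c + d) * (b + c + d + 1) * (b + c + d + 2) / 6

/-- Adds an exponent to a set of exponents modulo two. -/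
def toggle (e : Expo) : List Expo → List Expo
  | [] => [e]
  | f :: l => if e = f then l else f :: toggle e l

/-- Removes pairs of equal entries. -/
def cancel (l : List Expo) : List Expo := l.foldr toggle []

theorem listPoly_toggle (e : Expo) (l : List Expo) :
    listPoly (toggle e l) = expoMono e + listPoly l := by
  induction l with
  | nil => rfl
  | cons f l ih =>
    rw [toggle]
    split_ifs with h
    · rw [listPoly_cons, h, ← add_assoc, CharTwo.add_self_eq_zero, zero_add]
    · rw [listPoly_cons, ih, listPoly_cons, add_left_comm]

theorem listPoly_cancel (l : List Expo) : listPoly (cancel l) = listPoly l := by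
  induction l with
  | nil => rfl
  | cons e l ih =>
    rw [cancel, List.foldr_cons, listPoly_toggle, ← cancel, ih, listPoly_cons]

theorem mem_of_mem_toggle {e f : Expo} {l : List Expo} (h : f ∈ toggle e l) : f = e ∨ f ∈ l := by
  induction l with
  | nil => simpa [toggle] using h
  | cons g l ih =>
    rw [toggle] at h
    split_ifs at h with hg
    · exact Or.inr (List.mem_cons_of_mem _ h)
    · rcases List.mem_cons.1 h with h | h
      · exact Or.inr (h ▸ List.mem_cons_self)
      · exact (ih h).imp_right (List.mem_cons_of_mem _)

theorem mem_of_mem_cancel {f : Expo} {l : List Expo} (h : f ∈ cancel l) : f ∈ l := by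
  induction l with
  | nil => exact h
  | cons e l ih =>
    rcases mem_of_mem_toggle h with h | h
    · exact h ▸ List.mem_cons_self
    · exact List.mem_cons_of_mem _ (ih h)

/-- Given the set `K` of the ranks of the monomials known to be in some subspace that contains the
hit polynomials, adds the monomial that is left of a sum of Steenrod squares of monomials. -/
def learn (n K : ℕ) (h : List (ℕ × Expo)) : ℕ :=
  if h.all fun p => 0 < p.1 ∧ p.2.deg + p.1 = n then
    match cancel ((h.flatMap fun p => sqTerms p.1 p.2).filter fun e => !K.testBit (rank e)) with
    | [e] => K ||| 1 <<< rank e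
    | _ => K
  else K

/-- The square `Sq^i` (for `i` among `1, 2, 4, 8`) and the monomial of degree `n - i` that are
packed into `17` bits. -/
def decodeHint (n h : ℕ) : ℕ × Expo :=
  (2 ^ (h % 4), n - 2 ^ (h % 4) - h / 4 % 32 - h / 128 % 32 - h / 4096 % 32,
    h / 4 % 32, h / 128 % 32, h / 4096 % 32)

/-- Applies `learn` to the squares of monomials that are packed into `w`. The test for `K = 0` makes
the kernel evaluate `K` at every step. -/
def learnChunk (n : ℕ) : ℕ → ℕ → ℕ → ℕ
  | 0, _, K => K
  | k + 1, w, K =>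
    if K = 0 then K else learnChunk n k (w / 131072) (learn n K [decodeHint n (w % 131072)])

/-- Starts from the monomials in `B` and applies `learn` repeatedly. -/
def learnAll (n : ℕ) (B : List Expo) (ws : List ℕ) (hs : List (List (ℕ × Expo))) : ℕ :=
  hs.foldl (learn n) (ws.foldl (fun K w => learnChunk n 60 w K)
    (B.foldl (fun K e => K ||| 1 <<< rank e) 0))

/-- The monomials of degree `n` with rank in `K` are in `V`. -/
def Known (V : Submodule (ZMod 2) (Poly 4)) (n K : ℕ) : Prop :=
  ∀ e : Expo, e.deg = n → K.testBit (rank e) = true → expoMono e ∈ V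

/-! ### Injectivity of the ranking of monomials in a fixed degree -/

theorem triangle_succ (s : ℕ) : (s + 1) * (s + 1 + 1) / 2 = s * (s + 1) / 2 + (s + 1) := by
  rw [← Nat.add_mul_div_left _ _ two_pos]
  congr 1
  ring

theorem tetrahedron_succ (s : ℕ) : (s + 1) * (s + 1 + 1) * (s + 1 + 2) / 6 =
    s * (s + 1) * (s + 2) / 6 + (s + 1) * (s + 1 + 1) / 2 := by
  have h : (s + 1) * (s + 1 + 1) = 2 * ((s + 1) * (s + 1 + 1) / 2) :=
    (Nat.two_mul_div_two_of_even (Nat.even_mul_succ_self _)).symm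
  rw [← Nat.add_mul_div_left _ _ (by norm_num : 0 < 6)]
  congr 1
  linear_combination 3 * h

/-- With s = b + c + d and t = c + d, the rank is C(s+2, 3) + C(t+1, 2) + d, where d ≤ t ≤ s. The
last two terms stay below C(s+2, 2), the gap to the next tetrahedral number, so the rank determines
s. -/
theorem rank_bounds (a b c d : ℕ) :
    (b + c + d) * (b + c + d + 1) * (b + c + d + 2) / 6 ≤ rank (a, b, c, d) ∧
    rank (a, b, c, d) < (b + c + d + 1) * (b + c + d + 1 + 1) * (b + c + d + 1 + 2) / 6 := by
  have h1 : (c + d) * (c + d + 1) / 2 ≤ (b + c + d) * (b + c + d + 1) / 2 :=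
    Nat.div_le_div_right (Nat.mul_le_mul (by omega) (by omega))
  rw [tetrahedron_succ, triangle_succ, rank]
  omega

theorem eq_of_between {f : ℕ → ℕ} (hf : Monotone f) {s t x : ℕ} (h1 : f s ≤ x) (h2 : x < f (s + 1))
    (h3 : f t ≤ x) (h4 : x < f (t + 1)) : s = t := by
  have h5 := hf.reflect_lt (h1.trans_lt h4)
  have h6 := hf.reflect_lt (h3.trans_lt h2)
  omega

/-- The numbers b + c + d, c + d and d are recovered in this order, from the tetrahedral and then
the triangular intervals. The first exponent comes from the degree, which the rank does not see. -/
theorem rank_injective {e f : Expo} (hd : e.deg = f.deg) (h : rank e = rank f) : e = f := by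
  obtain ⟨a, b, c, d⟩ := e
  obtain ⟨a', b', c', d'⟩ := f
  have hs : b + c + d = b' + c' + d' := by
    have h1 := rank_bounds a b c d
    have h2 := rank_bounds a' b' c' d'
    exact eq_of_between (f := fun s => s * (s + 1) * (s + 2) / 6)
      (fun s t hst => Nat.div_le_div_right (Nat.mul_le_mul (Nat.mul_le_mul hst (by omega))
        (by omega))) h1.1 h1.2 (h ▸ h2.1) (h ▸ h2.2)
  have ht : c + d = c' + d' := by
    simp only [rank, hs] at h
    refine eq_of_between (f := fun s => s * (s + 1) / 2) (x := d + (c + d) * (c + d + 1) / 2)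
      (fun s t hst => Nat.div_le_div_right (Nat.mul_le_mul hst (by omega))) ?_ ?_ ?_ ?_
    · exact Nat.le_add_left _ _
    · rw [triangle_succ]
      omega
    · omega
    · rw [triangle_succ]
      omega
  simp only [rank, hs, ht] at h
  simp only [Expo.deg] at hd
  have h4 : d = d' := by omega
  simp only [Prod.mk.injEq]
  omega

theorem rank_lt {n : ℕ} {e : Expo} (h : e.deg = n) :
    rank e < (n + 1) * (n + 2) * (n + 3) / 6 := by
  obtain ⟨a, b, c, d⟩ := e
  simp only [Expo.deg] at h
  exact (rank_bounds a b c d).2.trans_le (Nat.div_le_div_right (Nat.mul_le_mul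
    (Nat.mul_le_mul (by omega) (by omega)) (by omega)))

/-! ### Soundness of the elimination -/

theorem Known.insert {V : Submodule (ZMod 2) (Poly 4)} {n K : ℕ}
    (hK : Known V n K) {e : Expo} (hn : e.deg = n)
    (he : expoMono e ∈ V) : Known V n (K ||| 1 <<< rank e) := by
  intro f hf h
  rw [Nat.testBit_or, Bool.or_eq_true] at h
  rcases h with h | h
  · exact hK f hf h
  · rw [Nat.one_shiftLeft, Nat.testBit_two_pow, decide_eq_true_iff] at h
    exact rank_injective (hn.trans hf.symm) h ▸ he

/-- The sum of squares is hit, hence in V, and its known terms are in V. If the rest cancels modulo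
two to a single monomial, that monomial is a difference of two elements of V. In every other case
nothing is added. -/
theorem Known.learn {V : Submodule (ZMod 2) (Poly 4)} (hV : hits 4 ≤ V) {n K : ℕ}
    (hK : Known V n K) (h : List (ℕ × Expo)) :
    Known V n (learn n K h) := by
  unfold HitProblem.learn
  split_ifs with hh
  swap
  · exact hK
  simp only [List.all_eq_true, decide_eq_true_eq] at hh
  set l := h.flatMap fun p => sqTerms p.1 p.2 with hl
  have hdeg : ∀ e ∈ l, e.deg = n := by
    intro e he
    obtain ⟨p, hp, he⟩ := List.mem_flatMap.1 he
    rw [deg_of_mem_sqTerms he, (hh p hp).2]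
  have hlV : listPoly l ∈ V := by
    rw [listPoly, hl, sum_map_flatMap]
    refine list_sum_mem fun f hf => ?_
    obtain ⟨p, hp, rfl⟩ := List.mem_map.1 hf
    refine hV ?_
    have := mem_hits_of_Sq (hh p hp).1 (expoMono p.2)
    rwa [Sq_expoMono] at this
  split
  next e he =>
    have hmem : e ∈ l := List.mem_of_mem_filter (mem_of_mem_cancel (he ▸ List.mem_singleton_self e))
    refine hK.insert (hdeg e hmem) ?_
    have h1 : expoMono e = listPoly (l.filter fun e => !K.testBit (rank e)) := by
      rw [← listPoly_cancel, he]
      simp [listPoly]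
    have h2 : listPoly (l.filter fun e => K.testBit (rank e)) +
        listPoly (l.filter fun e => !K.testBit (rank e)) = listPoly l :=
      listPoly_filter_add _ l
    rw [h1, ← add_sub_cancel_left (listPoly (l.filter fun e => K.testBit (rank e)))
      (listPoly (l.filter fun e => !K.testBit (rank e))), h2]
    refine V.sub_mem hlV (listPoly_mem fun f hf => ?_)
    rw [List.mem_filter] at hf
    exact hK f (hdeg f hf.1) hf.2
  next => exact hK

/-- The packed hints need no correctness assumption: `learn` itself checks degrees and positivity.
Any word is sound, including one whose top is padded with zeros. -/
theorem Known.learnChunk {V : Submodule (ZMod 2) (Poly 4)} (hV : hits 4 ≤ V) {n : ℕ} (k w : ℕ) {K : ℕ} (hK : Known V n K) :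
    Known V n (learnChunk n k w K) := by
  induction k generalizing w K with
  | zero => exact hK
  | succ k ih =>
    rw [HitProblem.learnChunk]
    split_ifs
    · exact hK
    · exact ih _ (hK.learn hV _)

/-- If `learnAll` finds every monomial of degree `n`, then the monomials in `B` span the
polynomials of degree `n` modulo hit polynomials. -/
theorem polyDeg_le_of_learnAll {n N : ℕ} {B : List Expo} {ws : List ℕ}
    {hs : List (List (ℕ × Expo))} (hN : (n + 1) * (n + 2) * (n + 3) / 6 = N)
    (hB : ∀ e ∈ B, e.deg = n) (h : learnAll n B ws hs = 2 ^ N - 1) :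
    PolyDeg 4 n ≤ hits 4 ⊔ Submodule.span (ZMod 2) (expoMono '' {e | e ∈ B}) := by
  set V := hits 4 ⊔ Submodule.span (ZMod 2) (expoMono '' {e | e ∈ B})
  have hV : hits 4 ≤ V := le_sup_left
  have hBV : ∀ e ∈ B, expoMono e ∈ V := fun e he =>
    Submodule.mem_sup_right (Submodule.subset_span ⟨e, he, rfl⟩)
  have h0 : ∀ (l : List Expo) (K : ℕ), (∀ e ∈ l, e ∈ B) → Known V n K →
      Known V n (l.foldl (fun K e => K ||| 1 <<< rank e) K) := by
    intro l
    induction l with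
    | nil => exact fun K _ hK => hK
    | cons e l ih =>
      intro K hl hK
      have he := hl e List.mem_cons_self
      exact ih _ (fun f hf => hl f (List.mem_cons_of_mem _ hf)) (hK.insert (hB e he) (hBV e he))
  have h1 : ∀ (l : List ℕ) (K : ℕ), Known V n K →
      Known V n (l.foldl (fun K w => HitProblem.learnChunk n 60 w K) K) := by
    intro l
    induction l with
    | nil => exact fun K hK => hK
    | cons w l ih => exact fun K hK => ih _ (hK.learnChunk hV 60 w)
  have h2 : ∀ (l : List (List (ℕ × Expo))) (K : ℕ), Known V n K →
      Known V n (l.foldl (HitProblem.learn n) K) := by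
    intro l
    induction l with
    | nil => exact fun K hK => hK
    | cons w l ih => exact fun K hK => ih _ (hK.learn hV w)
  have hK : Known V n (learnAll n B ws hs) :=
    h2 _ _ (h1 _ _ (h0 B 0 (fun _ he => he) fun e _ he => by simp at he))
  rw [h] at hK
  intro f hf
  refine Submodule.span_le.2 ?_ (mem_span_expoMono hf)
  rintro _ ⟨e, he, rfl⟩
  refine hK e he ?_
  -- All N low bits are set, and N, the number of monomials of degree n, exceeds every rank.
  rw [Nat.testBit_two_pow_sub_one, decide_eq_true_iff, ← hN]
  exact rank_lt he

/-! ### Linear functionals given by bit vectors -/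

/-- The vector of binary digits of a number. -/
def bits (x : ℕ) : ℕ → ZMod 2 := fun j => if x.testBit j then 1 else 0

theorem bits_zero : bits 0 = 0 := by
  funext j
  simp [bits]

theorem bits_xor (x y : ℕ) : bits (x ^^^ y) = bits x + bits y := by
  funext j
  simp only [bits, Nat.testBit_xor, Pi.add_apply]
  cases x.testBit j <;> cases y.testBit j <;> decide

theorem bits_injective : Function.Injective bits := by
  intro x y h
  refine Nat.eq_of_testBit_eq fun j => ?_
  have := congrFun h j
  simp only [bits] at this
  revert this
  cases x.testBit j <;> cases y.testBit j <;> simp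

theorem bits_shiftLeft (x s : ℕ) : bits (x <<< s) = fun j => if s ≤ j then bits x (j - s) else 0 := by
  funext j
  simp only [bits, Nat.testBit_shiftLeft]
  split_ifs <;> simp_all

/-- The bitwise sum of the values of `C` on a list. -/
def xorSum {α : Type*} (C : α → ℕ) (l : List α) : ℕ := (l.map C).foldr (· ^^^ ·) 0

theorem bits_xorSum {α : Type*} (C : α → ℕ) (l : List α) :
    bits (xorSum C l) = (l.map fun e => bits (C e)).sum := by
  induction l with
  | nil => exact bits_zero
  | cons e l ih => rw [List.map_cons, List.sum_cons, ← ih, ← bits_xor]; rfl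

/-- The linear map that carries the monomials of degree `n` to the bit vectors given by `C`, and
those of other degrees to zero. -/
noncomputable def codeMap (n : ℕ) (C : Expo → ℕ) : Poly 4 →ₗ[ZMod 2] (ℕ → ZMod 2) :=
  (MvPolynomial.basisMonomials (Fin 4) (ZMod 2)).constr (ZMod 2) fun s =>
    if Expo.deg (s 0, s 1, s 2, s 3) = n then bits (C (s 0, s 1, s 2, s 3)) else 0

theorem codeMap_expoMono (n : ℕ) (C : Expo → ℕ) (e : Expo) :
    codeMap n C (expoMono e) = if e.deg = n then bits (C e) else 0 := by
  rw [expoMono_eq_monomial]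
  have := (MvPolynomial.basisMonomials (Fin 4) (ZMod 2)).constr_basis (ZMod 2) (fun s =>
    if Expo.deg (s 0, s 1, s 2, s 3) = n then bits (C (s 0, s 1, s 2, s 3)) else 0)
    (Finsupp.equivFunOnFinite.symm ![e.1, e.2.1, e.2.2.1, e.2.2.2])
  rw [MvPolynomial.coe_basisMonomials] at this
  exact this

theorem codeMap_listPoly {n : ℕ} (C : Expo → ℕ) {l : List Expo} (h : ∀ e ∈ l, e.deg = n) :
    codeMap n C (listPoly l) = bits (xorSum C l) := by
  rw [listPoly, map_list_sum_map, bits_xorSum]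
  refine congrArg List.sum (List.map_congr_left fun e he => ?_)
  rw [codeMap_expoMono, if_pos (h e he)]

/-- The bit vectors given by `C` define functionals on the polynomials of degree `n` that vanish on
hit polynomials. -/
def KillsHits (n : ℕ) (C : Expo → ℕ) : Prop :=
  ∀ i e, 0 < i → Expo.deg e + i = n → xorSum C (sqTerms i e) = 0

theorem expoMono_induction {p : Poly 4 → Prop} (f : Poly 4) (h0 : p 0)
    (hadd : ∀ f g, p f → p g → p (f + g)) (h : ∀ e, p (expoMono e)) : p f := by
  induction f using MvPolynomial.induction_on' with
  | add f g hf hg => exact hadd f g hf hg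
  | monomial s c =>
    have hc : c = 0 ∨ c = 1 := by revert c; decide
    rcases hc with rfl | rfl
    · rwa [MvPolynomial.monomial_zero]
    · rw [monomial_eq_expoMono]
      exact h _

/-- By linearity only squares of monomials matter. Such a square is homogeneous: in degree n the
hypothesis applies, and in other degrees `codeMap` is zero by definition. -/
theorem KillsHits.codeMap_eq_zero {n : ℕ} {C : Expo → ℕ} (hC : KillsHits n C) {f : Poly 4}
    (hf : f ∈ hits 4) : codeMap n C f = 0 := by
  have : hits 4 ≤ LinearMap.ker (codeMap n C) := by
    refine iSup_le fun i => iSup_le fun hi => ?_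
    rintro _ ⟨g, rfl⟩
    rw [LinearMap.mem_ker]
    induction g using expoMono_induction with
    | h0 => simp
    | hadd f g hf hg => rw [map_add, map_add, hf, hg, add_zero]
    | h e =>
      rw [Sq_expoMono]
      by_cases he : e.deg + i = n
      · rw [codeMap_listPoly C fun f hf => (deg_of_mem_sqTerms hf).trans he, hC i e hi he,
          bits_zero]
      · rw [listPoly, map_list_sum_map]
        refine List.sum_eq_zero fun x hx => ?_
        obtain ⟨f, hf, rfl⟩ := List.mem_map.1 hx
        rw [codeMap_expoMono, if_neg]
        rwa [deg_of_mem_sqTerms hf]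
  exact this hf

/-- The converse passage: when the bit vectors come from a linear map with an algebraic description,
vanishing on hits can be proved by algebra and not by enumeration. -/
theorem KillsHits.of_linearMap {n : ℕ} {C : Expo → ℕ} (φ : Poly 4 →ₗ[ZMod 2] (ℕ → ZMod 2))
    (hφ : ∀ e, Expo.deg e = n → φ (expoMono e) = bits (C e))
    (h : ∀ i e, 0 < i → Expo.deg e + i = n → φ (Sq 4 i (expoMono e)) = 0) : KillsHits n C := by
  intro i e hi he
  refine bits_injective ?_
  rw [bits_zero, ← h i e hi he, Sq_expoMono, listPoly, map_list_sum_map, bits_xorSum]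
  refine congrArg List.sum (List.map_congr_left fun f hf => ?_)
  rw [hφ f ((deg_of_mem_sqTerms hf).trans he)]

/-! ### Joining several functionals into one bit vector -/

theorem xorSum_xor {α : Type*} (C D : α → ℕ) (l : List α) :
    xorSum (fun e => C e ^^^ D e) l = xorSum C l ^^^ xorSum D l := by
  refine bits_injective ?_
  rw [bits_xor, bits_xorSum, bits_xorSum, bits_xorSum]
  simp only [bits_xor]
  exact List.sum_map_add

theorem xorSum_shiftLeft {α : Type*} (C : α → ℕ) (s : ℕ) (l : List α) :
    xorSum (fun e => C e <<< s) l = xorSum C l <<< s := by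
  induction l with
  | nil => simp [xorSum]
  | cons e l ih =>
    have : ∀ D : α → ℕ, xorSum D (e :: l) = D e ^^^ xorSum D l := fun _ => rfl
    rw [this, this, ih, Nat.shiftLeft_xor_distrib]

theorem KillsHits.xor {n : ℕ} {C D : Expo → ℕ} (hC : KillsHits n C) (hD : KillsHits n D) :
    KillsHits n fun e => C e ^^^ D e := by
  intro i e hi he
  rw [xorSum_xor, hC i e hi he, hD i e hi he, Nat.xor_self]

theorem KillsHits.shiftLeft {n : ℕ} {C : Expo → ℕ} (hC : KillsHits n C) (s : ℕ) :
    KillsHits n fun e => C e <<< s := by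
  intro i e hi he
  rw [xorSum_shiftLeft, hC i e hi he, Nat.zero_shiftLeft]

/-- The values of the `C x` with `x` in `l`, placed in successive blocks of `s` bits. -/
def packBits {α : Type*} (s : ℕ) (C : α → Expo → ℕ) : List α → Expo → ℕ
  | [], _ => 0
  | x :: l, e => C x e ^^^ packBits s C l e <<< s

theorem KillsHits.packBits {n : ℕ} {α : Type*} {C : α → Expo → ℕ} {l : List α}
    (s : ℕ)
    (hC : ∀ x ∈ l, KillsHits n (C x)) : KillsHits n (packBits s C l) := by
  induction l with
  | nil =>
    intro i e _ _
    refine bits_injective ?_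
    rw [bits_xorSum, bits_zero]
    refine List.sum_eq_zero fun x hx => ?_
    obtain ⟨f, -, rfl⟩ := List.mem_map.1 hx
    exact bits_zero
  | cons x l ih =>
    exact (hC x List.mem_cons_self).xor
      ((ih fun y hy => hC y (List.mem_cons_of_mem _ hy)).shiftLeft s)

/-! ### Directional derivatives at a point -/

/-- Squares have derivative zero in characteristic two, so the derivative of x_l + x_l^2 T by x_j is
1 if l = j and 0 otherwise, the same as for x_l. Hence the derivation commutes with the total
square; the induction multiplies by one variable at a time. -/
theorem pderiv_Sq (j : Fin 4) (i : ℕ) (f : Poly 4) :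
    MvPolynomial.pderiv j (Sq 4 i f) = Sq 4 i (MvPolynomial.pderiv j f) := by
  have key : ∀ f : Poly 4, ∀ i, MvPolynomial.pderiv j ((sqTotal 4 f).coeff i) =
      (sqTotal 4 (MvPolynomial.pderiv j f)).coeff i := by
    intro f
    induction f using MvPolynomial.induction_on with
    | C c => intro i; simp [sqTotal, Polynomial.coeff_C]; split_ifs <;> simp
    | add f g hf hg => intro i; simp [hf, hg]
    | mul_X f l hf =>
      intro i
      have hX : ∀ g : Poly 4, ∀ i, (sqTotal 4 (g * MvPolynomial.X l)).coeff i =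
          (sqTotal 4 g).coeff i * MvPolynomial.X l +
          if 1 ≤ i then (sqTotal 4 g).coeff (i - 1) * MvPolynomial.X l ^ 2 else 0 := by
        intro g i
        have h1 : sqTotal 4 (MvPolynomial.X l) = Polynomial.C (MvPolynomial.X l) +
          Polynomial.C (MvPolynomial.X l ^ 2) * Polynomial.X ^ 1 := by simp [sqTotal]
        rw [map_mul, h1, mul_add, Polynomial.coeff_add, Polynomial.coeff_mul_C, ← mul_assoc,
          Polynomial.coeff_mul_X_pow', Polynomial.coeff_mul_C]
      have h2 : MvPolynomial.pderiv j (MvPolynomial.X l ^ 2 : Poly 4) = 0 := by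
        rw [Derivation.leibniz_pow, two_nsmul, CharTwo.add_self_eq_zero]
      have h3 : MvPolynomial.pderiv j (MvPolynomial.X l : Poly 4) = if l = j then 1 else 0 := by
        rw [MvPolynomial.pderiv_X, Pi.single_apply]
      rw [hX, map_add, Derivation.leibniz, hf, Derivation.leibniz, map_add, Polynomial.coeff_add]
      simp only [smul_eq_mul]
      rw [mul_comm (MvPolynomial.X l) (MvPolynomial.pderiv j f), hX, h3]
      split_ifs
      all_goals simp [Derivation.leibniz, h2, hf]
      all_goals ring
  exact key f i

/-- Coordinates in F_2 satisfy a^2 = a, so x_j + x_j^2 T takes the value a_j (1 + T). The total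
square of a monomial of degree d thus evaluates to its value times (1 + T)^d. -/
theorem eval_Sq_expoMono (a : Fin 4 → ZMod 2) (i : ℕ) (e : Expo) :
    MvPolynomial.eval a (Sq 4 i (expoMono e)) =
      (e.deg.choose i : ZMod 2) * MvPolynomial.eval a (expoMono e) := by
  have hc : ∀ c : ZMod 2, c ^ 2 = c := by decide
  have hf : ∀ f : Poly 4, MvPolynomial.eval a (Sq 4 i f) =
      ((sqTotal 4 f).map (MvPolynomial.eval a)).coeff i := by
    intro f
    rw [Polynomial.coeff_map]
    rfl
  have hX : ∀ j, (sqTotal 4 (MvPolynomial.X j)).map (MvPolynomial.eval a) =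
      Polynomial.C (a j) * (1 + Polynomial.X) := by
    intro j
    have h2 : MvPolynomial.eval a (MvPolynomial.X j ^ 2) = a j := by
      rw [map_pow, MvPolynomial.eval_X, hc]
    simp only [sqTotal, MvPolynomial.aeval_X, Polynomial.map_add, Polynomial.map_mul,
      Polynomial.map_C, Polynomial.map_X, MvPolynomial.eval_X, h2, mul_add, mul_one]
  obtain ⟨p, q, r, s⟩ := e
  rw [hf]
  simp only [expoMono, mono, map_mul, map_pow, Polynomial.map_mul, Polynomial.map_pow, hX,
    MvPolynomial.eval_X, mul_pow, Expo.deg]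
  have : (Polynomial.C (a 0) ^ p * (1 + Polynomial.X) ^ p * (Polynomial.C (a 1) ^ q *
      (1 + Polynomial.X) ^ q) * (Polynomial.C (a 2) ^ r * (1 + Polynomial.X) ^ r) *
      (Polynomial.C (a 3) ^ s * (1 + Polynomial.X) ^ s) : Polynomial (ZMod 2)) =
      Polynomial.C (a 0 ^ p * a 1 ^ q * a 2 ^ r * a 3 ^ s) *
        (1 + Polynomial.X) ^ (p + q + r + s) := by
    simp only [map_mul, map_pow]
    ring
  rw [this, Polynomial.coeff_C_mul, Polynomial.coeff_one_add_X_pow, mul_comm]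

/-- The value of a monomial at a point with coordinates `0` and `1`. -/
def evalCode : Bool × Bool × Bool × Bool → Expo → Bool
  | (p, q, r, s), (a, b, c, d) =>
    (p || a == 0) && (q || b == 0) && (r || c == 0) && (s || d == 0)

/-- A coordinate of an exponent. -/
def coord (j : Fin 4) : Expo → ℕ
  | (a, b, c, d) => match j with
    | 0 => a
    | 1 => b
    | 2 => c
    | 3 => d

/-- Changes a coordinate of an exponent. -/
def setCoord (j : Fin 4) (m : ℕ) : Expo → Expo
  | (a, b, c, d) => match j with
    | 0 => (m, b, c, d)
    | 1 => (a, m, c, d)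
    | 2 => (a, b, m, d)
    | 3 => (a, b, c, m)

/-- The value at a point of the `j`-th partial derivative of a monomial. -/
def derivCode (x : (Bool × Bool × Bool × Bool) × Fin 4) (e : Expo) : ℕ :=
  if coord x.2 e % 2 = 1 ∧ evalCode x.1 (setCoord x.2 (coord x.2 e - 1) e) = true then 1 else 0

/-- The point with given coordinates. -/
def boolPoint : Bool × Bool × Bool × Bool → Fin 4 → ZMod 2
  | (p, q, r, s) => ![p.toNat, q.toNat, r.toNat, s.toNat]

theorem eval_expoMono (x : Bool × Bool × Bool × Bool) (e : Expo) :
    MvPolynomial.eval (boolPoint x) (expoMono e) = if evalCode x e = true then 1 else 0 := by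
  obtain ⟨p, q, r, s⟩ := x
  obtain ⟨a, b, c, d⟩ := e
  have h : ∀ (p : Bool) (a : ℕ),
      ((p.toNat : ZMod 2)) ^ a = if (p || a == 0) = true then 1 else 0 := by
    intro p a
    cases p <;> simp [zero_pow_eq]
  simp only [expoMono, mono, map_mul, map_pow, MvPolynomial.eval_X, boolPoint, evalCode,
    Matrix.cons_val, h]
  have h4 : ∀ P Q R S : Bool, ((if P = true then 1 else 0) * (if Q = true then 1 else 0) *
      (if R = true then 1 else 0) * (if S = true then 1 else 0) : ZMod 2) =
      if (P && Q && R && S) = true then 1 else 0 := by decide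
  exact h4 _ _ _ _

theorem natCast_zmod_two (m : ℕ) : (m : ZMod 2) = if m % 2 = 1 then 1 else 0 := by
  rw [← ZMod.natCast_mod]
  rcases Nat.mod_two_eq_zero_or_one m with h | h <;> rw [h] <;> simp

theorem pderiv_expoMono (j : Fin 4) (e : Expo) :
    MvPolynomial.pderiv j (expoMono e) =
      if coord j e % 2 = 1 then expoMono (setCoord j (coord j e - 1) e) else 0 := by
  rw [expoMono_eq_monomial, MvPolynomial.pderiv_monomial, one_mul]
  have h1 : Finsupp.equivFunOnFinite.symm ![e.1, e.2.1, e.2.2.1, e.2.2.2] j = coord j e := by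
    fin_cases j <;> rfl
  rw [h1, natCast_zmod_two]
  split_ifs
  · rw [monomial_eq_expoMono]
    congr 1
    obtain ⟨a, b, c, d⟩ := e
    fin_cases j <;> simp [coord, setCoord]
  · rw [MvPolynomial.monomial_zero]

theorem deg_setCoord (j : Fin 4) (m : ℕ) (e : Expo) :
    (setCoord j m e).deg + coord j e = e.deg + m := by
  obtain ⟨a, b, c, d⟩ := e
  fin_cases j <;> simp [coord, setCoord, Expo.deg] <;> omega

/-- In five binary digits 31 - i is the complement of i, so a nonzero i is not a submask of it. This
is special to degrees 2^k - 1, here the degree 31 of a derivative of a form of degree 32. -/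
theorem even_choose_thirty_one (i : ℕ) (h0 : 0 < i) (h : i ≤ 31) : Even ((31 - i).choose i) := by
  by_cases h2 : 31 - i < i
  · rw [Nat.choose_eq_zero_of_lt h2]
    exact Even.zero
  · have : i < 16 := by omega
    interval_cases i <;> simp [Nat.choose] <;> decide

/-- Commuting the derivative past Sq^i leaves Sq^i of a monomial of degree 31 - i, evaluated at a
point; the resulting binomial coefficient is even. -/
theorem derivCode_killsHits (x : (Bool × Bool × Bool × Bool) × Fin 4) :
    KillsHits 32 (derivCode x) := by
  have hev : ∀ f : Poly 4, MvPolynomial.aeval (boolPoint x.1) f =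
      MvPolynomial.eval (boolPoint x.1) f := fun f =>
    DFunLike.congr_fun (MvPolynomial.coe_aeval_eq_eval (boolPoint x.1)) f
  -- The scalar functional is placed in bit 0 and the other bits are zero.
  refine KillsHits.of_linearMap ((LinearMap.single (ZMod 2) (fun _ : ℕ => ZMod 2) 0).comp
    ((MvPolynomial.aeval (boolPoint x.1)).toLinearMap.comp
      (MvPolynomial.pderiv x.2).toLinearMap)) ?_ ?_
  · intro e _
    have h1 : MvPolynomial.eval (boolPoint x.1) (MvPolynomial.pderiv x.2 (expoMono e)) =
        (derivCode x e : ZMod 2) := by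
      rw [pderiv_expoMono, derivCode]
      split_ifs with h2 h3 h3
      · rw [eval_expoMono, if_pos h3.2, Nat.cast_one]
      · rw [eval_expoMono, if_neg fun h => h3 ⟨h2, h⟩, Nat.cast_zero]
      · exact absurd h3.1 h2
      · simp
    change (Pi.single 0 (MvPolynomial.aeval (boolPoint x.1)
      (MvPolynomial.pderiv x.2 (expoMono e))) : ℕ → ZMod 2) = _
    rw [hev, h1]
    funext j
    rw [derivCode]
    split_ifs
    · cases j <;> simp [bits, Nat.testBit_succ]
    · simp [bits]
  · intro i e hi he
    change (Pi.single 0 (MvPolynomial.aeval (boolPoint x.1)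
      (MvPolynomial.pderiv x.2 (Sq 4 i (expoMono e)))) : ℕ → ZMod 2) = 0
    rw [hev, pderiv_Sq, pderiv_expoMono]
    split_ifs with h
    · rw [eval_Sq_expoMono]
      have hd := deg_setCoord x.2 (coord x.2 e - 1) e
      -- The coordinate is odd, hence positive, so lowering it by one really lowers the degree by
      -- one.
      have hdeg : (setCoord x.2 (coord x.2 e - 1) e).deg = 31 - i := by omega
      rw [hdeg, (ZMod.natCast_eq_zero_iff_even).2 (even_choose_thirty_one i hi (by omega)),
        zero_mul, Pi.single_zero]
    · rw [map_zero, map_zero, Pi.single_zero]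

/-! ### Functionals pulled back along the Kameko homomorphism -/

/-- The composite of a functional with the Kameko homomorphism. -/
def halfCode (C : Expo → ℕ) : Expo → ℕ
  | (a, b, c, d) => if a % 2 = 1 ∧ b % 2 = 1 ∧ c % 2 = 1 ∧ d % 2 = 1 then
      C ((a - 1) / 2, (b - 1) / 2, (c - 1) / 2, (d - 1) / 2) else 0

theorem kamekoPoly_expoMono (a b c d : ℕ) : kamekoPoly 4 (expoMono (a, b, c, d)) =
    if a % 2 = 1 ∧ b % 2 = 1 ∧ c % 2 = 1 ∧ d % 2 = 1 then
      expoMono ((a - 1) / 2, (b - 1) / 2, (c - 1) / 2, (d - 1) / 2) else 0 := by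
  rw [expoMono_eq_monomial, kamekoPoly_monomial]
  simp only [monomial_eq_expoMono, Fin.forall_fin_succ, IsEmpty.forall_iff]
  simp [Nat.odd_iff, Finsupp.mapRange_apply]

/-- The Kameko map sends hit polynomials to hit polynomials, so functionals that kill hits pull back
to such functionals. -/
theorem KillsHits.halfCode {m : ℕ} {C : Expo → ℕ} (hC : KillsHits m C) :
    KillsHits (2 * m + 4) (halfCode C) := by
  refine KillsHits.of_linearMap ((codeMap m C).comp (kamekoPoly 4)) ?_ ?_
  · rintro ⟨a, b, c, d⟩ he
    simp only [Expo.deg] at he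
    rw [LinearMap.comp_apply, kamekoPoly_expoMono, HitProblem.halfCode]
    split_ifs with h
    · rw [codeMap_expoMono, if_pos]
      simp only [Expo.deg]
      omega
    · rw [map_zero, bits_zero]
  · intro i e hi _
    exact hC.codeMap_eq_zero (kamekoPoly_Sq_mem_hits i hi _)

/-! ### Linear independence of bit vectors -/

/-- A linear combination of bit vectors. -/
def bitComb (c : ℕ → ZMod 2) : List ℕ → ℕ → ZMod 2
  | [] => 0
  | v :: l => c 0 • bits v + bitComb (fun i => c (i + 1)) l

/-- Tests by elimination, with at most `k` steps, whether bit vectors are independent. -/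
def bitsIndep : ℕ → List ℕ → Bool
  | _, [] => true
  | 0, _ :: _ => false
  | k + 1, v :: l =>
    v != 0 && bitsIndep k (l.map fun w => if w.testBit v.log2 then w ^^^ v else w)

theorem bitComb_eq_sum (c : ℕ → ZMod 2) (l : List ℕ) :
    bitComb c l = ∑ i : Fin l.length, c i • bits l[i] := by
  induction l generalizing c with
  | nil => rfl
  | cons v l ih =>
    rw [bitComb, ih]
    exact (Fin.sum_univ_succ (n := l.length)
      fun i : Fin (l.length + 1) => c i • bits (v :: l)[i]).symm

theorem bitComb_append (c : ℕ → ZMod 2) (l m : List ℕ) :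
    bitComb c (l ++ m) = bitComb c l + bitComb (fun i => c (i + l.length)) m := by
  induction l generalizing c with
  | nil => simp [bitComb]
  | cons v l ih =>
    rw [List.cons_append, bitComb, bitComb, ih, add_assoc]
    simp only [List.length_cons, add_assoc, add_comm]

/-- One step of Gaussian elimination at the pivot p: adding v to the vectors with bit p clears that
bit in all of them and changes any combination by a multiple of v. -/
theorem exists_bitComb_elim (v p : ℕ) (hp : v.testBit p = true) (l : List ℕ) (c : ℕ → ZMod 2) :
    bitComb c (l.map fun w => if w.testBit p then w ^^^ v else w) p = 0 ∧ ∃ s : ZMod 2,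
      bitComb c l = bitComb c (l.map fun w => if w.testBit p then w ^^^ v else w) + s • bits v := by
  induction l generalizing c with
  | nil => exact ⟨rfl, 0, by simp [bitComb]⟩
  | cons w l ih =>
    obtain ⟨h0, s, hs⟩ := ih fun i => c (i + 1)
    simp only [List.map_cons, bitComb]
    split_ifs with hw
    · refine ⟨?_, s + c 0, ?_⟩
      · rw [Pi.add_apply, h0, bits_xor]
        simp [bits, hw, hp, CharTwo.add_self_eq_zero]
      · rw [hs, bits_xor, smul_add, add_smul]
        have : c 0 • bits v + c 0 • bits v = 0 := by
          rw [← add_smul, CharTwo.add_self_eq_zero, zero_smul]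
        linear_combination (exp := 1) -this
    · refine ⟨?_, s, ?_⟩
      · rw [Pi.add_apply, h0]
        simp [bits, hw]
      · rw [hs, add_assoc]

/-- The pivot is the leading bit of the first vector. At the pivot the eliminated vectors vanish, so
the total coefficient c 0 + s of v is zero; the induction hypothesis then kills the other
coefficients. -/
theorem eq_zero_of_bitsIndep {k : ℕ} {l : List ℕ} (h : bitsIndep k l = true) {c : ℕ → ZMod 2}
    (hc : bitComb c l = 0) {i : ℕ} (hi : i < l.length) : c i = 0 := by
  induction k generalizing l c i with
  | zero =>
    cases l with
    | nil => simp at hi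
    | cons v l => simp [bitsIndep] at h
  | succ k ih =>
    cases l with
    | nil => simp at hi
    | cons v l =>
      rw [bitsIndep, Bool.and_eq_true, bne_iff_ne] at h
      have hp : v.testBit v.log2 = true := Nat.testBit_log2 h.1
      obtain ⟨h0, s, hs⟩ := exists_bitComb_elim v _ hp l fun i => c (i + 1)
      rw [bitComb, hs] at hc
      have hsum : c 0 + s = 0 := by
        have := congrFun hc v.log2
        simp only [Pi.add_apply, h0, Pi.smul_apply, bits, hp] at this
        simpa using this
      have hc' : bitComb (fun i => c (i + 1))
          (l.map fun w => if w.testBit v.log2 then w ^^^ v else w) = 0 := by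
        rw [add_left_comm, ← add_smul, hsum, zero_smul, add_zero] at hc
        exact hc
      have hall : ∀ i, i < l.length → c (i + 1) = 0 := fun i hi =>
        ih h.2 hc' (by rwa [List.length_map])
      cases i with
      | succ i => exact hall i (by simpa using hi)
      | zero =>
        -- With all later coefficients zero, the correction s is zero as well, again read at the
        -- pivot, and c 0 + s = 0 gives the first coefficient.
        have hz : bitComb (fun i => c (i + 1)) l = 0 := by
          rw [bitComb_eq_sum]
          exact Finset.sum_eq_zero fun i _ => by rw [hall i i.2, zero_smul]
        rw [hz] at hs
        have := congrFun hs v.log2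
        simp only [Pi.add_apply, h0, Pi.smul_apply, bits, hp] at this
        have hs0 : s = 0 := by simpa using this.symm
        rwa [hs0, add_zero] at hsum

theorem linearIndependent_of_bitsIndep {k : ℕ} {l : List ℕ} (h : bitsIndep k l = true) :
    LinearIndependent (ZMod 2) fun i : Fin l.length => bits l[i] := by
  rw [Fintype.linearIndependent_iff]
  intro g hg i
  -- Coefficients are indexed by all natural numbers in `bitComb`, so g is extended by zero.
  have := eq_zero_of_bitsIndep h (c := fun j => if hj : j < l.length then g ⟨j, hj⟩ else 0)
    (by rw [bitComb_eq_sum, ← hg]; exact Finset.sum_congr rfl fun i _ => by simp) i.2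
  simpa using this

/-! ### Cohit spaces with a known basis of monomials -/

/-- Monomials that span `(QP_4)_n`, and functionals that show their independence. -/
structure CohitBasis (n : ℕ) where
  /-- The exponents of the monomials. -/
  B : List Expo
  /-- The functionals. -/
  C : Expo → ℕ
  deg_eq : ∀ e ∈ B, Expo.deg e = n
  spans : PolyDeg 4 n ≤ hits 4 ⊔ Submodule.span (ZMod 2) (expoMono '' {e | e ∈ B})
  kills : KillsHits n C
  indep : ∃ k, bitsIndep k (B.map C) = true

namespace CohitBasis

variable {n : ℕ} (D : CohitBasis n)

/-- The bit vector of a cohit class. -/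
noncomputable def code : QP 4 n →ₗ[ZMod 2] (ℕ → ZMod 2) :=
  (hitsDeg 4 n).liftQ ((codeMap n D.C).comp (PolyDeg 4 n).subtype) fun _ hf =>
    LinearMap.mem_ker.2 (D.kills.codeMap_eq_zero hf)

theorem code_mk (f : Poly 4) (hf : f.IsHomogeneous n) : D.code (QP.mk f hf) = codeMap n D.C f :=
  rfl

/-- The class of a basis monomial. -/
noncomputable def cls (i : Fin D.B.length) : QP 4 n :=
  QP.mk (expoMono D.B[i]) (expoMono_isHomogeneous (D.deg_eq _ (List.getElem_mem i.2)))

theorem code_cls (i : Fin D.B.length) : D.code (D.cls i) = bits (D.C D.B[i]) := by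
  rw [cls, code_mk, codeMap_expoMono]
  exact if_pos (D.deg_eq _ (List.getElem_mem i.2))

theorem linearIndependent_cls : LinearIndependent (ZMod 2) D.cls := by
  refine LinearIndependent.of_comp D.code ?_
  obtain ⟨k, hk⟩ := D.indep
  have h := linearIndependent_of_bitsIndep hk
  have := h.comp (Fin.cast (List.length_map (as := D.B) D.C).symm) (Fin.cast_injective _)
  convert this using 1
  funext i
  simp [code_cls]

/-- A form of degree n is a hit polynomial plus a combination of basis monomials, and only the
second summand affects the class. -/
theorem span_cls : ⊤ ≤ Submodule.span (ZMod 2) (Set.range D.cls) := by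
  rintro v -
  obtain ⟨⟨f, hf⟩, rfl⟩ := Submodule.mkQ_surjective _ v
  obtain ⟨h, hh, g, hg, rfl⟩ := Submodule.mem_sup.1 (D.spans hf)
  -- The class of g exists only once g is known to be homogeneous, so the induction over the span
  -- carries this along with the conclusion.
  have key : ∀ g ∈ Submodule.span (ZMod 2) (expoMono '' {e | e ∈ D.B}),
      ∃ hg : g ∈ PolyDeg 4 n, (hitsDeg 4 n).mkQ ⟨g, hg⟩ ∈
        Submodule.span (ZMod 2) (Set.range D.cls) := by
    intro g hg
    induction hg using Submodule.span_induction with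
    | mem g hg =>
      obtain ⟨e, he, rfl⟩ := hg
      obtain ⟨i, hi, rfl⟩ := List.getElem_of_mem he
      exact ⟨expoMono_mem (D.deg_eq _ he), Submodule.subset_span ⟨⟨i, hi⟩, rfl⟩⟩
    | zero => exact ⟨Submodule.zero_mem _, Submodule.zero_mem _⟩
    | add x y _ _ hx hy =>
      obtain ⟨hx, hx'⟩ := hx
      obtain ⟨hy, hy'⟩ := hy
      exact ⟨Submodule.add_mem _ hx hy, Submodule.add_mem _ hx' hy'⟩
    | smul c x _ hx =>
      obtain ⟨hx, hx'⟩ := hx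
      exact ⟨Submodule.smul_mem _ c hx, Submodule.smul_mem _ c hx'⟩
  obtain ⟨hg', hg''⟩ := key g hg
  convert hg'' using 1
  rw [Submodule.mkQ_apply, Submodule.mkQ_apply, Submodule.Quotient.eq]
  change h + g - g ∈ hits 4
  rwa [add_sub_cancel_right]

/-- The basis of monomials. -/
noncomputable def basis : Module.Basis (Fin D.B.length) (ZMod 2) (QP 4 n) :=
  Module.Basis.mk D.linearIndependent_cls D.span_cls

theorem finrank_eq : Module.finrank (ZMod 2) (QP 4 n) = D.B.length := by
  rw [Module.finrank_eq_card_basis D.basis, Fintype.card_fin]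

theorem finite (D : CohitBasis n) : Module.Finite (ZMod 2) (QP 4 n) :=
  Module.Finite.of_basis D.basis

/-- The coefficients of a class. -/
noncomputable def coeffs (v : QP 4 n) (i : ℕ) : ZMod 2 :=
  if hi : i < D.B.length then D.basis.repr v ⟨i, hi⟩ else 0

theorem sum_coeffs (v : QP 4 n) : v = ∑ i : Fin D.B.length, D.coeffs v i • D.cls i := by
  conv_lhs => rw [← D.basis.sum_repr v]
  refine Finset.sum_congr rfl fun i _ => ?_
  simp [coeffs, basis]

/-- Reduces a linear map on the cohit space to the list of its values on basis monomials, the form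
on which elimination operates. -/
theorem map_eq_bitComb (φ : QP 4 n →ₗ[ZMod 2] (ℕ → ZMod 2)) (R : Expo → ℕ)
    (h : ∀ i, φ (D.cls i) = bits (R D.B[i])) (v : QP 4 n) :
    φ v = bitComb (D.coeffs v) (D.B.map R) := by
  conv_lhs => rw [D.sum_coeffs v]
  rw [map_sum, bitComb_eq_sum]
  refine Fintype.sum_equiv (finCongr (List.length_map (as := D.B) R).symm) _ _ fun i => ?_
  simp [h]

/-- The codes of the basis monomials are independent, so the functionals separate classes and
equality in the cohit space can be tested on bit vectors. -/
theorem code_injective : Function.Injective D.code := by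
  rw [injective_iff_map_eq_zero]
  intro v hv
  obtain ⟨k, hk⟩ := D.indep
  rw [D.map_eq_bitComb D.code D.C D.code_cls] at hv
  rw [D.sum_coeffs v]
  refine Finset.sum_eq_zero fun i _ => ?_
  rw [eq_zero_of_bitsIndep hk hv (by simp), zero_smul]

/-- If a linear map that vanishes on a subspace `I` has independent values on all basis monomials
but the first `r`, then `I` has dimension at most `r`. -/
theorem finrank_le (I : Submodule (ZMod 2) (QP 4 n)) (φ : QP 4 n →ₗ[ZMod 2] (ℕ → ZMod 2))
    (R : Expo → ℕ) (h : ∀ i, φ (D.cls i) = bits (R D.B[i])) (hI : ∀ v ∈ I, φ v = 0) {r k : ℕ}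
    (hr : bitsIndep k ((D.B.drop r).map R) = true) (hrB : r ≤ D.B.length) :
    Module.finrank (ZMod 2) I ≤ r := by
  -- The bound is an injection of I into the first r coordinates. If these vanish on v, then φ v = 0
  -- is a relation between the remaining independent values, so all coordinates of v vanish.
  set ψ : I →ₗ[ZMod 2] (Fin r → ZMod 2) :=
    (LinearMap.pi fun i : Fin r => D.basis.coord (Fin.castLE hrB i)).comp I.subtype with hψ
  have hinj : Function.Injective ψ := by
    rw [injective_iff_map_eq_zero]
    rintro ⟨v, hv⟩ h0
    have hlow : ∀ i, i < r → D.coeffs v i = 0 := by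
      intro i hi
      have := congrFun h0 ⟨i, hi⟩
      rw [coeffs, dif_pos (hi.trans_le hrB)]
      exact this
    have h1 := hI v hv
    rw [D.map_eq_bitComb φ R h, ← List.take_append_drop r D.B, List.map_append,
      bitComb_append] at h1
    have hlen : (List.map R (List.take r D.B)).length = r := by simp [hrB]
    have h2 : bitComb (D.coeffs v) (List.map R (List.take r D.B)) = 0 := by
      rw [bitComb_eq_sum]
      exact Finset.sum_eq_zero fun i _ => by rw [hlow i (lt_of_lt_of_eq i.2 hlen), zero_smul]
    rw [h2, zero_add, hlen] at h1
    refine Subtype.ext ?_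
    change v = 0
    rw [D.sum_coeffs v]
    refine Finset.sum_eq_zero fun i _ => ?_
    rcases lt_or_ge (i : ℕ) r with hi | hi
    · rw [hlow i hi, zero_smul]
    · have := eq_zero_of_bitsIndep hr h1 (i := i - r) (by
        rw [List.length_map, List.length_drop]
        omega)
      simp only [Nat.sub_add_cancel hi] at this
      rw [this, zero_smul]
  have := LinearMap.finrank_le_finrank_of_injective hinj
  rwa [Module.finrank_fin_fun] at this

theorem eq_span_of_linearIndependent (D : CohitBasis n) (I : Submodule (ZMod 2) (QP 4 n)) {r : ℕ}
    (hI : Module.finrank (ZMod 2) I ≤ r) {s : Fin r → QP 4 n} (hs : LinearIndependent (ZMod 2) s)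
    (hsI : ∀ j, s j ∈ I) :
    Module.finrank (ZMod 2) I = r ∧ I = Submodule.span (ZMod 2) (Set.range s) := by
  have := D.finite
  have hle : Submodule.span (ZMod 2) (Set.range s) ≤ I :=
    Submodule.span_le.2 (Set.range_subset_iff.2 hsI)
  have hr : Module.finrank (ZMod 2) (Submodule.span (ZMod 2) (Set.range s)) = r := by
    rw [finrank_span_eq_card hs, Fintype.card_fin]
  have heq := Submodule.eq_of_le_of_finrank_le hle (hr.symm ▸ hI)
  exact ⟨heq ▸ hr, heq.symm⟩

end CohitBasis

/-! ### Generators of the general linear group and of the symmetric group -/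

/-- Generators: the transpositions of adjacent variables and the substitutions
`x_j ↦ x_j + x_i`. -/
inductive Move : Type
  | swap (k : Fin 3)
  | shear (i j : Fin 4)

/-- The matrix of a generator. -/
noncomputable def Move.mat : Move → Matrix (Fin 4) (Fin 4) (ZMod 2)
  | swap k => (permGL 4 (Equiv.swap k.castSucc k.succ) : Matrix (Fin 4) (Fin 4) (ZMod 2))
  | shear i j => Matrix.transvection i j 1

/-- The substitutions `x_i ↦ x_i + x_i` are excluded. -/
def Move.Valid : Move → Prop
  | swap _ => True
  | shear i j => i ≠ j

/-- The terms of the image of a monomial under a generator. -/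
def Move.terms : Move → Expo → List Expo
  | swap k, (a, b, c, d) => match k with
    | 0 => [(b, a, c, d)]
    | 1 => [(a, c, b, d)]
    | 2 => [(a, b, d, c)]
  | shear i j, e => (submasks ((coord j e).log2 + 1) (coord j e)).map fun t =>
      setCoord i (coord i e + t) (setCoord j (coord j e - t) e)

theorem le_of_mem_submasks {k m t : ℕ} (h : t ∈ submasks k m) : t ≤ m := by
  induction k generalizing m t with
  | zero => simp_all [submasks]
  | succ k ih =>
    rw [submasks] at h
    split_ifs at h with hm
    · obtain ⟨u, hu, h⟩ := List.mem_flatMap.1 h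
      have := ih hu
      simp only [List.mem_cons, List.not_mem_nil, or_false] at h
      omega
    · obtain ⟨u, hu, h⟩ := List.mem_map.1 h
      have := ih hu
      omega

/-- Lucas' theorem in homogeneous form. As m has at most k binary digits, no truncation factor is
left over. -/
theorem add_pow_eq_submasks {R : Type*} [CommRing R] [CharP R 2] {k m : ℕ} (h : m < 2 ^ k)
    (x y : R) : (x + y) ^ m = ((submasks k m).map fun t => y ^ t * x ^ (m - t)).sum := by
  induction k generalizing m x y with
  | zero =>
    have : m = 0 := by simpa using h
    simp [this, submasks]
  | succ k ih =>
    have hq : (x + y) ^ (2 * (m / 2)) =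
        ((submasks k (m / 2)).map fun t => y ^ (2 * t) * x ^ (2 * (m / 2 - t))).sum := by
      rw [pow_mul, CharTwo.add_sq, ih (by rw [pow_succ] at h; omega)]
      simp only [← pow_mul]
    rcases Nat.mod_two_eq_zero_or_one m with hm | hm
    · have hm2 : m = 2 * (m / 2) := by omega
      rw [submasks, if_neg (by omega), List.map_map]
      nth_rewrite 1 [hm2]
      rw [hq]
      refine congrArg List.sum (List.map_congr_left fun t ht => ?_)
      rw [Function.comp_apply]
      congr 2
      omega
    · have hm2 : m = 2 * (m / 2) + 1 := by omega
      rw [submasks, if_pos hm, sum_map_flatMap]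
      nth_rewrite 1 [hm2]
      rw [pow_succ, hq, sum_map_mul]
      refine congrArg List.sum (List.map_congr_left fun t ht => ?_)
      have := le_of_mem_submasks ht
      have h1 : m - 2 * t = 2 * (m / 2 - t) + 1 := by omega
      have h2 : m - (2 * t + 1) = 2 * (m / 2 - t) := by omega
      simp only [List.map_cons, List.map_nil, List.sum_cons, List.sum_nil, h1, h2, pow_succ]
      ring

theorem coord_setCoord (i j : Fin 4) (m : ℕ) (e : Expo) :
    coord i (setCoord j m e) = if i = j then m else coord i e := by
  obtain ⟨a, b, c, d⟩ := e
  fin_cases i <;> fin_cases j <;> rfl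

theorem expoMono_eq_prod (e : Expo) :
    expoMono e = ∏ l, (MvPolynomial.X l : Poly 4) ^ coord l e := by
  obtain ⟨a, b, c, d⟩ := e
  rw [Fin.prod_univ_four]
  rfl

/-- The matrix is 1 + E_ij, and the image of x_l is read from its column l, so only x_j changes. -/
theorem subst_shear_X (i j l : Fin 4) :
    subst (Matrix.transvection i j (1 : ZMod 2)) (MvPolynomial.X l) =
      if l = j then MvPolynomial.X j + MvPolynomial.X i else MvPolynomial.X l := by
  have hA : ∀ p, MvPolynomial.C (Matrix.transvection i j (1 : ZMod 2) p l) * MvPolynomial.X p =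
      (if p = l then MvPolynomial.X p else 0) +
        (if p = i then (if l = j then MvPolynomial.X p else 0) else 0 : Poly 4) := by
    intro p
    rw [Matrix.transvection, Matrix.add_apply, Matrix.one_apply, Matrix.single_apply,
      ← ite_and, map_add, add_mul]
    simp only [eq_comm (a := p) (b := i), eq_comm (a := l) (b := j)]
    congr 1 <;> split_ifs <;> simp
  simp only [subst, MvPolynomial.aeval_X, hA, Finset.sum_add_distrib]
  simp only [Finset.sum_ite_eq', Finset.mem_univ, if_true]
  split_ifs with hl
  · rw [hl]
  · rw [add_zero]

theorem subst_mat_expoMono {m : Move} (hm : m.Valid) (e : Expo) :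
    subst m.mat (expoMono e) = listPoly (m.terms e) := by
  cases m with
  | swap k =>
    obtain ⟨a, b, c, d⟩ := e
    rw [Move.mat, subst_permGL]
    have h0 : ∀ k l : Fin 4, ∀ σ : Equiv.Perm (Fin 4), σ k = l →
      MvPolynomial.rename σ (MvPolynomial.X k : Poly 4) = MvPolynomial.X l := by
      rintro k _ σ rfl
      exact MvPolynomial.rename_X _ _
    fin_cases k
    · simp only [expoMono, mono, Move.terms, listPoly, map_mul, map_pow, List.map_cons,
        List.map_nil, List.sum_cons, List.sum_nil]
      rw [h0 0 1 _ (by decide), h0 1 0 _ (by decide), h0 2 2 _ (by decide), h0 3 3 _ (by decide)]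
      ring
    · simp only [expoMono, mono, Move.terms, listPoly, map_mul, map_pow, List.map_cons,
        List.map_nil, List.sum_cons, List.sum_nil]
      rw [h0 0 0 _ (by decide), h0 1 2 _ (by decide), h0 2 1 _ (by decide), h0 3 3 _ (by decide)]
      ring
    · simp only [expoMono, mono, Move.terms, listPoly, map_mul, map_pow, List.map_cons,
        List.map_nil, List.sum_cons, List.sum_nil]
      rw [h0 0 0 _ (by decide), h0 1 1 _ (by decide), h0 2 3 _ (by decide), h0 3 2 _ (by decide)]
      ring
  | shear i j =>
    have hij : i ≠ j := hm
    rw [Move.mat, expoMono_eq_prod, map_prod]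
    simp only [map_pow, subst_shear_X i j]
    -- Only the power of x_j is expanded: t of its factors turn into x_i. The factors of x_i, which
    -- is a different variable, are then collected and the other two remain unchanged.
    rw [← Finset.mul_prod_erase Finset.univ _ (Finset.mem_univ j), if_pos rfl,
      add_pow_eq_submasks (k := (coord j e).log2 + 1) Nat.lt_log2_self, sum_map_mul, Move.terms,
      listPoly, List.map_map]
    refine congrArg List.sum (List.map_congr_left fun t ht => ?_)
    have hi : i ∈ Finset.univ.erase j := Finset.mem_erase.2 ⟨hij, Finset.mem_univ i⟩
    rw [Function.comp_apply, expoMono_eq_prod,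
      ← Finset.mul_prod_erase Finset.univ _ (Finset.mem_univ j),
      ← Finset.mul_prod_erase _ _ hi, ← Finset.mul_prod_erase _ _ hi]
    have hrest : ∏ l ∈ (Finset.univ.erase j).erase i,
        (if l = j then MvPolynomial.X j + MvPolynomial.X i else MvPolynomial.X l : Poly 4) ^
          coord l e = ∏ l ∈ (Finset.univ.erase j).erase i, (MvPolynomial.X l : Poly 4) ^
          coord l (setCoord i (coord i e + t) (setCoord j (coord j e - t) e)) := by
      refine Finset.prod_congr rfl fun l hl => ?_
      simp only [Finset.mem_erase] at hl
      rw [if_neg hl.2.1, coord_setCoord, if_neg hl.1, coord_setCoord, if_neg hl.2.1]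
    rw [hrest, if_neg hij]
    simp only [coord_setCoord, if_true, if_neg hij.symm, if_neg hij, pow_add]
    ring

theorem deg_of_mem_terms {m : Move} (hm : m.Valid) {e f : Expo} (hf : f ∈ m.terms e) :
    f.deg = e.deg := by
  cases m with
  | swap k =>
    obtain ⟨a, b, c, d⟩ := e
    fin_cases k <;> simp only [Move.terms, List.mem_singleton] at hf <;> subst hf <;>
      simp only [Expo.deg] <;> omega
  | shear i j =>
    have hij : i ≠ j := hm
    obtain ⟨t, ht, rfl⟩ := List.mem_map.1 hf
    have h1 := deg_setCoord i (coord i e + t) (setCoord j (coord j e - t) e)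
    have h2 := deg_setCoord j (coord j e - t) e
    have h3 := le_of_mem_submasks ht
    rw [coord_setCoord, if_neg hij] at h1
    omega

theorem det_mat_ne_zero {m : Move} (hm : m.Valid) : m.mat.det ≠ 0 := by
  cases m with
  | swap k => exact ((Matrix.isUnit_iff_isUnit_det _).1 (permGL 4 _).isUnit).ne_zero
  | shear i j =>
    rw [Move.mat, Matrix.det_transvection_of_ne i j hm]
    exact one_ne_zero

theorem matAction_mat_of_glRep {n : ℕ} {v : QP 4 n} (hv : v ∈ (glRep 4 n).invariants) {m : Move}
    (hm : m.Valid) : matAction 4 n m.mat v = v :=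
  (Representation.mem_invariants _ v).1 hv
    (Matrix.GeneralLinearGroup.mkOfDetNeZero m.mat (det_mat_ne_zero hm))

theorem matAction_swap_of_symRep {n : ℕ} {v : QP 4 n} (hv : v ∈ (symRep 4 n).invariants)
    (k : Fin 3) : matAction 4 n (Move.swap k).mat v = v :=
  (Representation.mem_invariants _ v).1 hv (Equiv.swap k.castSucc k.succ)

/-- Transpositions of adjacent variables generate the symmetric group. -/
theorem mem_symRep_invariants {n : ℕ} {v : QP 4 n}
    (h : ∀ k, matAction 4 n (Move.swap k).mat v = v) : v ∈ (symRep 4 n).invariants := by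
  rw [Representation.mem_invariants]
  intro σ
  have hσ : σ ∈ Submonoid.closure
      (Set.range fun k : Fin 3 => Equiv.swap k.castSucc k.succ) := by
    rw [Equiv.Perm.mclosure_swap_castSucc_succ]
    exact Submonoid.mem_top σ
  induction hσ using Submonoid.closure_induction with
  | mem σ hσ =>
    obtain ⟨k, rfl⟩ := hσ
    exact h k
  | one => rw [map_one, Module.End.one_apply]
  | mul σ τ _ _ hσ hτ => rw [map_mul, Module.End.mul_apply, hτ, hσ]

/-- An invertible matrix is a product of transvections and a diagonal matrix; over F_2 an invertible
diagonal matrix is the identity, and the only nontrivial transvection parameter is 1. -/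
theorem mem_glRep_invariants {n : ℕ} {v : QP 4 n}
    (h : ∀ i j, i ≠ j → matAction 4 n (Move.shear i j).mat v = v) :
    v ∈ (glRep 4 n).invariants := by
  rw [Representation.mem_invariants]
  intro g
  change matAction 4 n (g : Matrix (Fin 4) (Fin 4) (ZMod 2)) v = v
  have h2 : ∀ c : ZMod 2, c = 0 ∨ c = 1 := by decide
  refine Matrix.diagonal_transvection_induction_of_det_ne_zero
    (fun A => matAction 4 n A v = v) _ ((Matrix.isUnit_iff_isUnit_det _).1 g.isUnit).ne_zero
    ?_ ?_ ?_
  · intro D hD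
    have : D = fun _ => 1 := by
      funext i
      rw [Matrix.det_diagonal, Finset.prod_ne_zero_iff] at hD
      exact (h2 (D i)).resolve_left (hD i (Finset.mem_univ i))
    rw [this, Matrix.diagonal_one, map_one, Module.End.one_apply]
  · rintro ⟨i, j, hij, c⟩
    rcases h2 c with rfl | rfl
    · simp [Matrix.TransvectionStruct.toMatrix]
    · exact h i j hij
  · intro A B _ _ hA hB
    rw [map_mul, Module.End.mul_apply, hB, hA]

/-! ### Defects of classes under generators -/

namespace CohitBasis

variable {n : ℕ} (D : CohitBasis n)

/-- The difference between the bit vectors of a monomial and of its image under a generator. -/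
def defect (C : Expo → ℕ) (m : Move) (e : Expo) : ℕ := xorSum C (m.terms e) ^^^ C e

/-- The difference between the bit vectors of a class and of its image under a generator. -/
noncomputable def defectMap (m : Move) : QP 4 n →ₗ[ZMod 2] (ℕ → ZMod 2) :=
  D.code.comp (matAction 4 n m.mat) + D.code

/-- In characteristic two the sum of two codes is their difference, and codes determine classes. -/
theorem defectMap_eq_zero_iff (m : Move) (v : QP 4 n) :
    D.defectMap m v = 0 ↔ matAction 4 n m.mat v = v := by
  change D.code (matAction 4 n m.mat v) + D.code v = 0 ↔ _
  have hneg : -D.code v = D.code v := funext fun i => ZMod.neg_eq_self_mod_two _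
  rw [add_eq_zero_iff_eq_neg, hneg]
  exact D.code_injective.eq_iff

theorem defectMap_mk {m : Move} (hm : m.Valid) {l : List Expo} (hl : ∀ e ∈ l, e.deg = n)
    (h : (listPoly l).IsHomogeneous n) :
    D.defectMap m (QP.mk (listPoly l) h) = bits (xorSum (defect D.C m) l) := by
  change codeMap n D.C (subst m.mat (listPoly l)) + codeMap n D.C (listPoly l) = _
  have h1 : subst m.mat (listPoly l) = listPoly (l.flatMap m.terms) := by
    rw [listPoly, map_list_sum_map, listPoly, sum_map_flatMap]
    exact congrArg List.sum (List.map_congr_left fun e _ => subst_mat_expoMono hm e)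
  rw [h1, codeMap_listPoly, codeMap_listPoly D.C hl, bits_xorSum, bits_xorSum, bits_xorSum,
    sum_map_flatMap, ← List.sum_map_add]
  · simp only [defect, bits_xor, bits_xorSum]
  · intro f hf
    obtain ⟨e, he, hf⟩ := List.mem_flatMap.1 hf
    rw [deg_of_mem_terms hm hf, hl e he]

theorem defectMap_cls {m : Move} (hm : m.Valid) (i : Fin D.B.length) :
    D.defectMap m (D.cls i) = bits (defect D.C m D.B[i]) := by
  have hl : ∀ e ∈ [D.B[i]], e.deg = n := by
    intro e he
    rw [List.mem_singleton.1 he]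
    exact D.deg_eq _ (List.getElem_mem i.2)
  have h1 : listPoly [D.B[i]] = expoMono D.B[i] := by simp [listPoly]
  have h2 : (listPoly [D.B[i]]).IsHomogeneous n :=
    h1 ▸ expoMono_isHomogeneous (hl _ (List.mem_singleton_self _))
  have h3 : D.cls i = QP.mk (listPoly [D.B[i]]) h2 :=
    congrArg (hitsDeg 4 n).mkQ (Subtype.ext h1.symm)
  rw [h3, D.defectMap_mk hm hl, bits_xorSum]
  simp

/-- Being fixed by several generators becomes the vanishing of one linear map, with one block of
bits per generator. The argument needs no bound on s: overlapping blocks could only make the test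
weaker. -/
theorem exists_packed_defectMap (s : ℕ) (l : List Move) (hl : ∀ m ∈ l, m.Valid) :
    ∃ φ : QP 4 n →ₗ[ZMod 2] (ℕ → ZMod 2),
      (∀ i, φ (D.cls i) = bits (packBits s (defect D.C) l D.B[i])) ∧
      ∀ v, (∀ m ∈ l, matAction 4 n m.mat v = v) → φ v = 0 := by
  induction l with
  | nil => exact ⟨0, fun i => bits_zero.symm, fun _ _ => rfl⟩
  | cons m l ih =>
    obtain ⟨φ, h1, h2⟩ := ih fun m hm => hl m (List.mem_cons_of_mem _ hm)
    refine ⟨D.defectMap m + (LinearMap.pi fun j =>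
      if s ≤ j then LinearMap.proj (j - s) else 0 :
        (ℕ → ZMod 2) →ₗ[ZMod 2] (ℕ → ZMod 2)).comp φ, fun i => ?_, fun v hv => ?_⟩
    · rw [LinearMap.add_apply, D.defectMap_cls (hl m List.mem_cons_self), packBits, bits_xor,
        bits_shiftLeft, LinearMap.comp_apply, h1]
      congr 1
      funext j
      rw [LinearMap.pi_apply]
      split_ifs <;> rfl
    · rw [LinearMap.add_apply, (D.defectMap_eq_zero_iff m v).2 (hv m List.mem_cons_self),
        LinearMap.comp_apply, h2 v fun m hm => hv m (List.mem_cons_of_mem _ hm), map_zero,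
        add_zero]

/-- A subspace fixed by generators is spanned by `r` independent classes in it, if the generators
move all basis monomials but the first `r` in independent ways. -/
theorem eq_span_of_fixed (I : Submodule (ZMod 2) (QP 4 n)) (s : ℕ) (l : List Move)
    (hl : ∀ m ∈ l, m.Valid) (hI : ∀ v ∈ I, ∀ m ∈ l, matAction 4 n m.mat v = v) {r k : ℕ}
    (hr : bitsIndep k ((D.B.drop r).map (packBits s (defect D.C) l)) = true)
    (hrB : r ≤ D.B.length) {f : Fin r → QP 4 n} (hf : LinearIndependent (ZMod 2) f)
    (hfI : ∀ j, f j ∈ I) :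
    Module.finrank (ZMod 2) I = r ∧ I = Submodule.span (ZMod 2) (Set.range f) := by
  obtain ⟨φ, h1, h2⟩ := D.exists_packed_defectMap s l hl
  exact D.eq_span_of_linearIndependent I
    (D.finrank_le I φ _ h1 (fun v hv => h2 v (hI v hv)) hr hrB) hf hfI

theorem matAction_mk_eq {m : Move} (hm : m.Valid) {l : List Expo} (hl : ∀ e ∈ l, e.deg = n)
    (hd : xorSum (defect D.C m) l = 0) (h : (listPoly l).IsHomogeneous n) :
    matAction 4 n m.mat (QP.mk (listPoly l) h) = QP.mk (listPoly l) h := by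
  rw [← D.defectMap_eq_zero_iff, D.defectMap_mk hm hl, hd, bits_zero]

end CohitBasis

/-! ### Degree 14 -/

/-- Monomials that form a basis of `(QP_4)_14`. -/
def basis14 : List Expo := [
  (1, 1, 6, 6), (0, 0, 7, 7), (0, 1, 6, 7), (0, 1, 7, 6), (0, 3, 5, 6), (0, 7, 0, 7),
  (0, 7, 1, 6), (0, 7, 7, 0), (1, 0, 6, 7), (1, 0, 7, 6), (1, 2, 4, 7), (1, 2, 5, 6),
  (1, 2, 7, 4), (1, 3, 4, 6), (1, 3, 6, 4), (1, 6, 0, 7), (1, 6, 1, 6), (1, 6, 7, 0),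
  (1, 7, 0, 6), (1, 7, 2, 4), (1, 7, 6, 0), (3, 0, 5, 6), (3, 1, 4, 6), (3, 1, 6, 4),
  (3, 3, 4, 4), (3, 5, 0, 6), (3, 5, 2, 4), (3, 5, 6, 0), (7, 0, 0, 7), (7, 0, 1, 6),
  (7, 0, 7, 0), (7, 1, 0, 6), (7, 1, 2, 4), (7, 1, 6, 0), (7, 7, 0, 0), (1, 3, 3, 7),
  (1, 3, 7, 3), (1, 7, 3, 3), (3, 1, 3, 7), (3, 1, 7, 3), (3, 3, 1, 7), (3, 3, 3, 5),
  (3, 3, 5, 3), (3, 3, 7, 1), (3, 5, 3, 3), (3, 7, 1, 3), (3, 7, 3, 1), (7, 1, 3, 3),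
  (7, 3, 1, 3), (7, 3, 3, 1)]

/-- Steenrod squares of monomials, in the order in which `learn` uses them. -/
def squares14 : List ℕ := [
  0x1888140402610320828841c0202800330029001c4012000102808900c08024303118280c04c4064205110380805020661052083884240202a00340029801c8012200b0000818044a06050122018901408026303218288c1c0602820331029081c441202015081a0414c20e41091085804058006a0054003980248016200d000,
  0x1000180014000e00090005800340040002200300009000c400a0001300190014400e0001400198014800e20090000a800d000a600720048802c0002c0035002a001cc012400b1006800800040202200300008080442060101200188014000203011101808048206210500809800c800a200700008100446060301210,
  0x98084074412a228530428448426221501081688294452a6095124298a15410a1089088284264222a1305085484494262a150508c084644270211a109c8856046002301119009c0046042321138088d004e402b00118028c054640a700518128c854e02a34053902ac0146102309119409c2046142329138488d204e502b081,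
  0x18a81414a100528029c01ca000102509c294614e10e50800850044806040132028901c0802a40532048902c080234030a009d014680e14015a029d024681614400a2015110298014404a2215300a89014c40aa00508008401420122081080c882444502608108148828445226091124098a0541021081088084034410a1111,
  0x19868ce30641c718948c2146286110308418830c608613830a018890ce046900330238010c670623a30a4188b0c6486712348419830ce096008700a38072c200e204b08438831c60805084084014a102508508029c204e00e5085184384314200014002a0025001694010a0285204280e1c050a4187204008280454060a0125,
  0x38401c404e30061813806a4030a01c3002484014408e128710d38c618634a018300d180a0c0646038301228c00c6046500330119c00c8092110908438449c210e20a910428831c240e212510a18060c0246008300a18070c0746048301a484614438e302918028c10ce106710320a180f0c6006202308018811465063323294,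
  0x11c4852202908128a0a8204c182614139411c685230261c108408440822422181090088484620240821050882044182214108c0887042a02148209d084e044742338121c108e84490222c158009c104468e00870093806180342500218108c0046082158111e0ac204e282308118a48021402823401192094e086742348119a,
  0x80d0c6246510328419828ca3065203309294414a10a312518828c218614a318519030c49c610e310418a09060443421281098088c84850422a2094104690230821a1004080508c14280813880905040b0203c1014100684030201c138011c0852002604230d0a0604e30241c1080088108264223810a0088904e1027121390,
  0x18460c2406212510430829c410e110408a08c80463023121284094404c2426181290114488a10430a318418c4106242330119408cc84a602528130d094608a344528219918cc0c650831a310519020c8246320320c18c60c43461303094188a8c85062325098284a14434a118608d304a18434e218708c204704070403a1024,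
  0x384694238e30a5186000f0ce14650c308518430c274612c000e01c200e240908028a01c11c2180718038d024600a380b08038a01c700270023a00a4004d00210011400ac004f006080128010d004600238061a028c00c6806500332019c00c9006300312018400c500638033a01a400cd00678a2185090188894220a1083089,
  0x631a1385094304e34251c109d084b04e18210c109e084684238230a118608ce84658e10a5086]

/-- Sums of Steenrod squares of monomials that `learn` uses at the end. -/
def sums14 : List (List (ℕ × Expo)) := [
  [(4, 1, 3, 3, 3), (2, 1, 3, 3, 5), (2, 1, 3, 5, 3)],
  [(4, 3, 1, 3, 3), (2, 3, 1, 3, 5), (2, 3, 1, 5, 3)],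
  [(4, 3, 3, 1, 3), (2, 3, 3, 1, 5), (2, 3, 5, 1, 3)],
  [(4, 3, 3, 3, 1), (2, 3, 3, 5, 1), (2, 3, 5, 3, 1)],
  [(2, 1, 3, 5, 3)],
  [(2, 3, 1, 5, 3)],
  [(2, 3, 5, 1, 3)],
  [(2, 5, 3, 1, 3)],
  [(2, 1, 5, 3, 3)],
  [(2, 5, 1, 3, 3)],
  [(2, 3, 3, 5, 1)],
  [(2, 3, 5, 3, 1)]]

/-- The coefficients, with respect to `basis14`, of the monomials of degree `14`, with `50` bits for
each. -/
def coeffs14 : List ℕ := [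
  0x0,
  0x0,
  0x0,
  0x0,
  0x800000000000080000000400000000000000010000000080000000000000002000000000000200000000000100000000000040000000000020000000000002000000000001000000000000800000000000080000000000080000000000040000000000000000000000000000000000000000000000000000000000,
  0x40000000000020000000000008000000000002000000000000800000000000200000000000080000000000040000000000020000000000010000000000004000000008000000000000000400000000000100000000000080000000000008000000000004000000000001000000000000400000000000100000000,
  0x14000000000005400000000001200000000000400000000000200000000000000000000000001000000000000000000000000200000000000000000000000080000000000050000000000010000000000008000000000000000000000000100000000000000000000000000400000000000400000000000000000,
  0x8000000000000000000000000000800000000000000000000002000000000101000000000050400000000018100010000005040000000001810001000000404000400000002000000000000000000000004000000000000000000000000c0000100000000000000000008000000000000000000000002000000,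
  0x1402000000000400000000000180400000000000000000000020000000000010000000000005000000000002000000000000004000000000002000000000001000000000000000000000000000000000000000000000000000000000000000004000000000000000000000800000000000000000,
  0x5040000000001010000000000604000400000141000000000040400040000018100010000000080000000002000000000001000800000000500000005800040000040000040000000000014010000000008000000000000000000000000000000000000010000000000008000000000000000000000000000000,
  0x40000000020000000000000000000000000000000000000800000000000000200000000000000000000000000000000000000000000000004000000001000000000000800800000000000000000000040080100000020000000000000010000000000000000000000008000,
  0x2000000000001000000000000000000000000000000000000000000000000008000000000000000000000001000000000000000000000001000000000000800000000000200000000000100000000000000000000000000000000000000000000000000000000000000000000000000000000,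
  0x2000000000000000000000000400000000000000000000000200000000000120000000000048000000000010001000000004000000000001400100000000500040000000200000000000000000000000000000000000000000000000000000100000000000000000000000000000000000000000000000000,
  0x200000000000000000000000000000000000000000000000000000000000000000000000000400000000000200400000000000000000000000000000000008000000000004000000000000000000000000000000000000000000000000010000000000000000000000002004000000000000,
  0x800000000000000000080000100000000000000000010000000000000000000000000000000000000000000000000000000000000000000000000000000000000000000000000000000000000000000000000000000000000000000000000000000000000000000000000000000001000000000000000000000000000,
  0x5040000000001010001000000404000000000181000100000060400040000000200000000008000000000005400000000001000000010000000000000000140000000000048000000000020000000000002000000000001000000000000400200000000140100000000050000000000020000000000000040000,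
  0x400000000100200400000040000000000020000000000008008000000000004000000000000000000000000000000000000000000400000000000000014020000080000000000000001000000010000000000000000180400002000000000000000000000000000000020000000001410000,
  0x400000000200000000000080000000000000020000000000000000000000000000000000000000000000000000000000000000000000000000000000000000000040000000000000001000000000000c00001000000200000000800000000000000000000000000000000000000000000000000000000000,
  0x400000000000000000000000000000000000000000000000000000000000000000000000000000000000000000000000000000000000000000000000000000000000000000000000000000000000000000000000000000000000000000000000000000000000000000000000000000000000000000000000000,
  0x20000000000012000000000004000000000001400100000000480000000000100010000000050004000000020000000000000000000000000200000000000000000000000060010000000000000000000004000000000000000000000004000000000002000000000000800000000000200000000000080000,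
  0x400000000000a0000000000020000000000010000000000004801000000000400000000000000000000000000000000000000000000000001000000000000000000000000200000000000000000000000020040000000000000000000004000000000000000,
  0x100000000000080100000000020000000000010000000000000000000000000000000000000000000000000000000000000000000000000000000000000000000000000000400000000000000000000000000100000000000000000000010000000000000000000000000000,
  0x4000000000000000000000000800000000000000000000000000000000000000000000000000000000000000000000000000000000000000000,
  0x8000000000000000080000000000020000000000010000000000000000000000000000000000000000000000000000000000000000000000000000000000000000000000000000000000000000000000000000000000000000000000000000000000000000000000000000000000000000000000000000000000000,
  0x400000000000800000000000480100000000000000000000028000000000010000000000001000000000000000000000000800000000000400000000000120000000000050004000000012000000000005000400000001000100000000800000000000400000000000200000000000080000,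
  0x200000000000000000200000000000180040000000040000004000000000000000000000000000000000000000000000000000000000000000000000000000000001000000000000800000000000000000000000000000000000020040000000010000000000000000000000000000,
  0x4000000001000000000000000000000000000000000000000000000000000000000000000000000000000000000000000000000000000000000000000000000000000004000000000002000000000000801000000000400000000000000000000000000000000000000000000000000000000000000000,
  0x400000000000200000000000000000000000000000000000000000000000000000000000000000000000000000000000000000000000000000000000000000000000000000000000000000000000000000400,
  0x0,
  0x40000000000000000000000002000000000000000000000000800000000000400000000000100000000000040000000000010000000000004000000000001000000000000800000000000000000000000000000000000000000000000000000000000000000000000000000000000000000000000000000,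
  0x8000000000000000000000000000000000000000000000000000000000000000000000000004000000000004000000000000000000000000000000000000100000000000020000000000000000000000000000000000000000000000000100000000000000000000000040000000000000,
  0x10000000000010000000000004000000000000800000000000000000000000000000000000000000000000000000000000000000000000000000000000000000000000000040000000000000000000000000,
  0x4000000000002000000000000000000000000000000000000000000000000000000000000000000000000000000000000000000000000000000000000000000000000000000000000000000000000000001000000000000000000000000200000000000000000000000000000000000000,
  0x2000000000000000000000000000000000000000000000000000000000000000000000000000000000000000000000000000000000000000000000000000000000000000000000000000000]

/-- The functionals on the polynomials of degree `14` that are dual to `basis14`. -/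
def code14 (e : Expo) : ℕ :=
  -- Each word holds twenty entries of 50 bits. The 34 words cover the 680 ranks of degree 14; the
  -- default 0 is used only beyond them.
  (coeffs14.getD (rank e / 20) 0 >>> (50 * (rank e % 20))) % 2 ^ 50

theorem deg_basis14 : ∀ e ∈ basis14, Expo.deg e = 14 := by decide +kernel

/-- There are 680 = C(17, 3) monomials of degree 14, and all of them are reached. -/
theorem learnAll14 : learnAll 14 basis14 squares14 sums14 = 2 ^ 680 - 1 := by decide +kernel

/-- The index is shifted to range over positive squares: Sq^(i+1) on monomials of degree 13 - i.
These squares span the hit polynomials of degree 14. -/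
theorem code14_check : ∀ i ∈ List.range 14, ∀ e ∈ exposOfDeg (13 - i),
    xorSum code14 (sqTerms (i + 1) e) = 0 := by decide +kernel

theorem code14_killsHits : KillsHits 14 code14 := by
  intro i e hi he
  have := code14_check (i - 1) (List.mem_range.2 (by omega)) e (mem_exposOfDeg (by omega))
  rwa [Nat.sub_add_cancel hi] at this

theorem bitsIndep14 : bitsIndep 50 (basis14.map code14) = true := by decide +kernel

/-- The basis of `(QP_4)_14`. -/
def cohitBasis14 : CohitBasis 14 where
  B := basis14
  C := code14
  deg_eq := deg_basis14
  spans := polyDeg_le_of_learnAll (N := 680) rfl deg_basis14 learnAll14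
  kills := code14_killsHits
  indep := ⟨50, bitsIndep14⟩

/-! ### Degree 32 -/

/-- Monomials that form a basis of `(QP_4)_32`. -/
def basis32 : List Expo := [
  (3, 3, 13, 13), (0, 0, 1, 31), (0, 0, 3, 29), (0, 1, 2, 29), (1, 1, 2, 28), (1, 2, 1, 28),
  (1, 1, 15, 15), (1, 3, 13, 15), (1, 7, 11, 13), (3, 5, 9, 15), (3, 7, 7, 15), (0, 0, 31, 1),
  (0, 1, 0, 31), (0, 1, 1, 30), (0, 1, 3, 28), (0, 1, 30, 1), (0, 1, 31, 0), (0, 3, 0, 29),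
  (0, 3, 1, 28), (0, 3, 29, 0), (0, 31, 0, 1), (0, 31, 1, 0), (1, 0, 0, 31), (1, 0, 1, 30),
  (1, 0, 2, 29), (1, 0, 3, 28), (1, 0, 30, 1), (1, 0, 31, 0), (1, 1, 0, 30), (1, 1, 30, 0),
  (1, 2, 0, 29), (1, 2, 4, 25), (1, 2, 5, 24), (1, 2, 28, 1), (1, 2, 29, 0), (1, 3, 0, 28),
  (1, 3, 4, 24), (1, 3, 28, 0), (1, 30, 0, 1), (1, 30, 1, 0), (1, 31, 0, 0), (3, 0, 0, 29),
  (3, 0, 1, 28), (3, 0, 29, 0), (3, 1, 0, 28), (3, 1, 4, 24), (3, 1, 28, 0), (3, 29, 0, 0),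
  (31, 0, 0, 1), (31, 0, 1, 0), (31, 1, 0, 0), (1, 3, 15, 13), (1, 15, 1, 15), (1, 15, 3, 13),
  (1, 15, 15, 1), (3, 1, 13, 15), (3, 1, 15, 13), (3, 5, 11, 13), (3, 5, 15, 9), (3, 7, 9, 13),
  (3, 7, 13, 9), (3, 13, 1, 15), (3, 13, 3, 13), (3, 13, 15, 1), (3, 15, 1, 13), (3, 15, 5, 9),
  (3, 15, 13, 1), (7, 1, 11, 13), (7, 3, 9, 13), (7, 3, 13, 9), (7, 7, 9, 9), (7, 11, 1, 13),
  (7, 11, 5, 9), (7, 11, 13, 1), (15, 1, 1, 15), (15, 1, 3, 13), (15, 1, 15, 1), (15, 3, 1, 13),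
  (15, 3, 5, 9), (15, 3, 13, 1), (15, 15, 1, 1), (3, 7, 15, 7), (3, 15, 7, 7), (7, 3, 7, 15),
  (7, 3, 15, 7), (7, 7, 3, 15), (7, 7, 7, 11), (7, 7, 11, 7), (7, 7, 15, 3), (7, 11, 7, 7),
  (7, 15, 3, 7), (7, 15, 7, 3), (15, 3, 7, 7), (15, 7, 3, 7), (15, 7, 7, 3)]

/-- Steenrod squares of monomials, in the order in which `learn` uses them. -/
def squares32 : List ℕ := [
  0xa8905c08038303b182d0c1e4613030b7186b0c3d46228313318a90c5c46320301d101e0816c40f42099105c0835c41ec2115109a0854c42e4219110d808078207a105c083d84268217210d8087b84458226a115408b984648236211d0080f800f800ba007c004d802e801b200f8008b804d802aa017400c9806c803a201f000,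
  0x1a2814d40e4a091505828059206a90544839a4249216290d0480ba00d900aa80744049a02c901a280f0400c1c0dce0ac7075384a1c2cce1a470f138881c064c0706057303b18254c16860d3307918444c260601a281c94160a0ee5096285a94350a1e65112289894540a036403a202c901e0812e40b6206a903d08226413220,
  0xa88c5c06038203b102d081e4413020b7106b083d44228213310a9085c44320201d081e0416c20f41099085c0435c21ec1115089a0454c22e4119108d804078007a005c003d80268017200d8007b80458026a015400b980648036201d000083c045c060e0126818b4141a026c0326028b01c18028b03358292c1c56120b01550,
  0x1a2414d20e49091485824059006a80544039a0249016280d0400b9c0d8e0aa707438499c2c8e1a270f0380c180dcc0ac6075304a182ccc1a460f1308818064a0705057283b14254a16850d3287914444a260501a201c9016080ee4096205a9035081e641122098905408036303a182c8c1e0612e30b6186a8c3d06226313218,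
  0x6a0c3cc6224313118a80c06c40742059103c0825c416c20d5107a0844c4264215110b8080702076105a083c84260216e10d6087a844502266115208b884640203a003c002d801e8013200b8006b803d8022a013400a9805c8032201b0000838045a060d0126018b01418026b0325828ac1c16028a0335029281c54120a01548,
  0x8b00c18024b03158282c04d4064a051503828051206690524838a4241202a80344029a01c9012280b0400b1c0d4e0a8707338491c2c4e1a07017301b18154c0e86093305918344c1e06018281b94158a0ea5094285994348a1e25110280c900e080ae4076204a902d081a640f22088904c080343039182c0c1dc612c30b518,
  0x49942c8a1a250f0280c100dc80ac4075204a102cc81a440f120881006460703057183b0c254616830d318790c4446260301a101c8816040ee2096105a8835041e621121098885404036103a082c841e0212e10b6086a843d02226113208a8845c02038003b002d001e4013000b7006b003d40228013300a9005c40320001068,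
  0x5a0834c41e4211110980806820721058083b84258216a10d408798444822621150080d800e800b20078004b802d801aa00f40089804c802a201700008300456060b0125018a8141402690324828a41c1202880334029201c501208015381a1c14ce0e4709138581c058c06a6054303998248c16260d0300b940d8a0aa507428,
  0x1c8016000ee0096005a8035001e601120098805400020b011501828049206290504809a00c900a28070400a1c0cce0a4707138481c054c0686053303918244c1606016281a94150a0e65092285894340a02e4036202a901d0812640b22068903c080303037182b0c1d4612830b318690c3c462203019101c0815c40ec209510,
  0x69803c802220130000828045206090124018a01410026703238289c1c0e02860333029181c4c1206015281a1414ca0e45091285814058806a4054203990248816240d0200b8c0d860aa307418498c2c861a230f0180c080dc40ac2075104a082cc41a420f110880806420701057083b04254216810d30879044442260101a00,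
  0xc000dc00ac0075004a002cc01a400f10088000412022803040091c0c4e0a07013301918144c0e06014281994148a0e25090280a900d080a640722048902c0802c3035182a0c1cc612430b118680c05c406c2055103a0824c416420d1107808060206e1056083a84250216610d208788444020320038002b801d8012a00b400,
  0x290c1c461203015101a0814c40e42091105808058206a1054083984248216210d0080b800d800aa00740049802c801a200f0000820044e0607012301898140c02650322828941c0a02840332029101c481204015181a0c14c60e4309118580c058406a2054103988248416220d0100b840d820aa10740849842c821a210f008,
  0x8900c08024303118280c04c4064205110380805020661052083884240202a00340029801c8012200b0000818044a06050122018901408026303218288c1c0602820331029081c441202015081a0414c20e41091085804058006a0054003980248016200d000081c044c0606012281894140a02640322028901c08028303318,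
  0x3dc022c013500aa005cc032401b100e80007c007c005d003e0026c017400d9007c0045c026c015500ba0064c036401d100f800800040202200300008080442060101200188014000203011101808048206210500809800c800a2007000081004460603012101888140402610320828841c0202800330029001c40120001028,
  0x3c802220130000d000e400b00077004b002d401a800f30089004c402a0001b001d0016400f00097005b0035401e8011300990054402e0001c001d8016800f20098005b8035801ea011400998054802e20190000e800f000b6007a004c802e001ae00f6008a804d002a6017200c8806c0003c003d002e001ec013400b9006c0,
  0x220013000a8005c0032001b000e8007c0040002200300009000c400a0001300190014400e0001400198014800e20090000a800d000a600720048802c0002c0035002a001cc012400b100680005c006c0055003a0024c016400d1007800060006e0056003a80250016600d200788044000320038002b801d8012a00b400698,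
  0xd8066c027a009308178413c205e10735017b013dc05e807302d781b3c0f5e04f7081b8415cc06e405701db80b6c2036103b180d880ec037a10130a978593c2e5e14735057b033dc15e80f7099b8495cc16e40db08cd844ec613620bd0849ac0bda09ef02f483b9c0dca0b630200000002000300028001c0012000b00068003c,
  0x5bc89e248f132b6993bd09da896b42d3a27a4ccca666342f2a279d0bd24a67233489aa4258a183a13918cb906dc4572129a08db8c8dca272509a1850742702107b025b823dc09ea097302d7829800bc009e002f003b800dc00b6003300578033c015e00f302978193c0e5e0477005b8035c066e025b004d802dc832e2237209,
  0xa94a4cc55e82d139c7a0ed4672643af32579134c496a14960965cc22a614f3227a894d421aa18f7086b851e8297210b60d358492c2bd645ed13168473433de11cf0a7b053d032e415b108d706b9c258e14715237b11b590dae46b8253c25a54acec4e96474b9595cac704e58473c13a518f22477223a921d4c8e684af44b889,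
  0x914ebcab1e362f2a9895238a9a672923959a46492362b18f60d7aca3d4562928e49670dab8ab5e748e3a57a4e39275cb2af68c7346b4eb1685ad2b4599a9d0d92778743d68de2c8f5628a724639a29d09daf18b80d6b4a2dc54f02c979c3c0eb56716c3a77253b132d495a948d326b84e58276e3296195b94658a36a719340d,
  0x29a30cb6463c232d219e88d324a974f0bc705e9c364e1a4b0c96862382da615920ad88d63c8b5e368f135885a344d96b48a5a55b4e29a74eb6276a94b5219a996f28a7955c462a23533187a0d3cca1e455312868963bd219e94f138689d34ca9ea30d51a5b8c1e0696a50762a3a162cce0e874724a58a42b934c692434b329c,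
  0x79c0bd20a67033481aa4058a0b24097205b9025c4172109a085b8c65c642c3236289b844dc2472121a089b8c0dca072501a1811874943696388a1c5595e28af4e3a272c9496218b196768a3b55a56292b52b58762d3ada1d4d5296864b639e218f14e97864bd32da9dab0cd5a57ac1c1695ad06e6a36362ade0d8f46a8a54c4,
  0x5cc02a604f3027a814d401aa08f7006b811e8097200b605358092c0bd605ed03168073413de01cf027b013d012e405b100d702b9c058e04710237811b410da046b0253825a40ace04e90474815940ac604e50473813a418f20477023a821d408e604af04b8815bc09e208f102b6813bc09da096b02d3827a40cca066302f282,
  0x3c0cad864ee4276225a90b4c88618230b918590c2c46152509a5850ac264e14470a15848ac224e124709938518c38461b230d218688c324a174b0c1585c9c308e182b0b1385c9c2c96152d09a9a04cca2663233291a9484cc45e824f419990cbc2866123308978493c265e144f32179114c26661433121a8505444ac1336092,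
  0xb8c258616a8093405a9424cc15e80cf4059902bcc15e40d3105a84258218e19270d128691d8a4ea6255321c148dcc46c6436391aa094d09e452f0a97858bc4c62160d1329054b82c8f41279112c890f02476223a121d0c8e484ae44f6097a88b5449c172b42959989d0c8e872b23968602c504e48473413a11ae0256e227812,
  0x884238218e15270b128593c225e122d0923ac09da04ad04f1817940b4a0934087a053c829641a2c08f6057a82b5419c10b6085c14258a14700a37051b030d8146a0a53065a02acc14e80c74055902b4211620a720639829d01cb8083c051d828e818740a39052b8336011700ab7053c031e0156c0a77053b032d415a60d7188,
  0x2d400ec047404778033c096600740239012c4019a096b00a58179c038e05cb02d7805c00b5a016e0278024bc01e005ab00b6014b401dc04ec04b5016a4038a0a63012181b8c058606a7013401a9404cc05e80513807a00d4602640312807980bc80a62035080b04164602e4037101c84068204ec0a75052a8348215e40af105,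
  0x3c80a6200d10534809240cce02470315807b00bd601ea03148072411da00cd02f28071409e200d102b6805340bd201c90332809140dc202c1027a803540bda01cd037280b14099604af0038012b400dc046c0455801b008d404a604e18169c02d005a500b3013a0124e00e802d1805900ac404e40473013a019a604b7003c01,
  0x38449c244a124309118448c248613230a128511d200c902b2805140ac601430271813940a4a00c504738031c08ca046302328219c08d204a90064825a40292056700a3814ac01d804eb0075014a4015409e100e08138409c2096102d08070414c202410311807900bc601e203108068812e2015102b78053c0a6600f4027980,
  0xa8484c44664135204b102e4032e0237009c8026801701296095b84658236a319320da84a4c456642b5214b106dc036e02b9014d0068c1b4a0bcb0cc5066a4730e49a71d438aaa4350c1ac70dc306e98754e59862cd28ee0c974a1c83165192b14b5066aa344d29e6150f8e0ba70565826b40f8d60aa9057382c941461025082,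
  0x781ac40d1c06cf03c701e9c164e0a4b0496822340eae039601d18228c0f4606c303518169407860ca305d182b0c154609a503e5812ac074e04c7025580aac034e02c701d3813ac115607a70463822ac0d4e07a70365816b4079e04b30159806bc059e03af026980ecc096a0496016b8865c242c1238084b044d4832a3213211,
  0x5820b40d160727042481e1c105a058b031381c9c0c96052d024680d5c012c00b700cb006dc052c02b501c9810d40526032f022880e3c086a0193011780cbc04a60135004b0032c131409a704d382aa4150c0ac705c302e8c1a4a0c8505a50649c924e2a290d030691836464b250e018b08c94866a234492a1d4c0b2405af02d,
  0x30231c0f0c07a7044302298134e0a86055282e0c184a0a8305918291413060a230492822140ea6019200d980a48055e028f00d780ac4051c02d301c900ecc092404b102c7818bc0b1e0531024701338035c02af01c700ebc091c04ae02d781a380d5a038b021680a2c064e044901c3810b40316022b00938091c064e046d03c,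
  0x1820940d06072303228160c0c460525024280d0c054601a3016180e8c094a04ca08539029c4152108608630428c814a108310519030cc14680a5406780238014e00a70065802b4011c00d30049002c4031e022f00c7804c4011a014b02c5016ac0d1406a702d381aa40d0c06cb03c501eac111408a904c38289c130e0929044,
  0x180c8c084a03850225840282052300720138c01c40521006082384018204e500628128c00c804a1003101190118604a50033011a0094e00a804700138012c005a0040d8d1802940196018a00d580a28054e01a7015480a180596038a01d5812280952058703138161c0a520486026380e18074e048602530169c0d0c06a503c,
  0x19ea08f54699824cd116b0cb7045ba21e518f2107586f6827b51c560a2b44d6c36bc135e897146b8845b61dca0ae5479182c8d154b0ea70553a29a51cd2126581a0a0d0d06c086c6436240d8406c2836301b12300128012c011400a900c38089c030e012900430031c010c00a600d380a18054a018301128020c02460245014,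
  0x90c2bca45e322f289894238a18b14038a11c4c8de847124778433c2bce11c70a38912c420e2246f2236921b508da646b4253a23a50aca856922d4845a44ace44e9247499594cac684e54473a13a512d2656742b4a16a5038a8a4532f29978d0bca86254121a198d05064822d2125a09ac84d482a92163a0b9c85cc832521a1a,
  0x64422a2256f08a7854c421e224ef2278914c481a24a67212391a24249226670923858a423d225e722f4918a4839248d10aa6857242c8a14e78063c1325c9de80cf42f3a071d09a265c93272b138d89caa4a55454c01a608d2e4678234b219608cae4638232b21a588cec46952549a5ac229614ed2275913b44a5a10cd0d3184,
  0x395094a89490ab38451c2a5210e91273913a4895248c90aa28558c228614e52271913944a4a10c50c738431c28ca84653231a119490d244a908348919c88d248693233a11a50952896380a1c1515c9cae4e38272c1496018b096760a3b152549d2a4e76274b14a58192c96b40a5a1534c9da64eb4276a14b5019a896f20a791,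
  0xa6a055342b98163e0ae485ef02e7a16c40b9b05ee43168192d0cd60687833521b9c0d8e86a90362c1d8c0e868725037321b920ec487a105b0a3d8425c3001b5c50ab29158c8aca25a508e18578c230619c552b2a958d8acac5a560e1b178d8306ca0d08e6897ac239615ad08b6895ac8ada45ad20e5917ac831648e53271a1,
  0x15c89321059121e040e8286e2439081c890e480aa48553219990d4c86a80534239a024c91e640d3228a84354496a40752239911d4496a10d30a798424c30b21477082b8515430aa14530a398423c30f20059023b8015c08aa0875002a8114c08e600930410f410768c3b081bc116d08f60497823d213dc09ae84b9026ac13d9,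
  0x95c84ac8275214a90a590c78043c222d908ec84b6425c022d219e808f44499214d00a6484f24297412c908e484ae8297213b909d905a242b12168a0acc85a642d2417890c44862486b8025c1135c856e42d7216c013590dec04f6228a90c58062a42f52189a0b54856a42d3418990bcc85e4835121b050cc486a10360c3b90,
  0x3ac211618c59232c918e88cb44a5a061d138e810748cd5236a91ad88dac4ad6065b13ad8116c8220a120611428c610430a1305094208a18490a338411c2852102a0a160613428d6104b0a17050b4209a18510a378413c286210320a1a0609448462425141199094c84a48271214890a4904aa42352129a0a4c84e64293411b9,
  0x9c105e002e0215810b4005c08330019010c4005e042f041b800d808660435001b020ec00740439001b810dc1076043d002d811ec012e086900248119c008e0445043280114088604630041821c400a2046f00278113410da004d0225811ac011608c50a329118c88ca24a508618538c210618cd0a36911ac88da24ad086585,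
  0x884a382596348a1a5594e28a75e138e09d70cabca31c51af1a470d2bca71c53ad4245a12b4e71683ad2a459929d098e84ab2255a0ab4e31681ad294598a9d0592738741d68ce2c8752548732539132c495a148e0a6984e482762448f22588ce3c875e24b10a49052d0292822c1380098084604250013020ac00540429001381,
  0x4a5219298c94aa2a5705299a55492ae295904aa1a90cd4b02a47152ace51472ab48c52469d8552b18760d3aca1d4552928649632d29da70cd3a58241c1295e70703a56a41b928d898e74863a53a4e19274cb2a768c33468e054af18380d2b4a0dc546c2c36252ace0d8746a4a54a431534c232411af21588c63c835e328f115,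
  0x3922a46f0e47a71c438a2a4310c18c60c5315aa82d5058862c55856282b4e46a91ac39169c6d0e26a90b4305b18714e57862bd2a220d114a778343d29620cd14648c70bc305e986d4e55862ad1922946f0647a50c418a28c8d8686a52b4199a8d0b4a758541e6252292956748a3a55a4e292752c4876254ace1d874eb487525,
  0x3a16a4ad0e66a74354a1a190d96f18b80c5406b1a514d2aa5955b4629a352f18780d4b4a1dc54f02a9814340b4ce326819240da14a48a5663292195994648a362718f40d894a3cc55e82b1414720b1cef0e878643d58de2c8f1447a779c3c0e1a0756b38b61c530ebce71e838e41d98ce4c872443ac0c45062ac2f1417a9244,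
  0x594628a352718740d494a1cc54e82a54165052ac271413a722548ce1c874e24a90a4305318294c52aa095584628234e42a918c39069c650e22a9094304b1c270c13a6195394618a34682a538c1a0694a50662a3216191294670643a50a418928c898a738341d19928d094a84cb3ac5a16290b58568a2b550daacab1455a93ac,
  0xa9e85310496c22c518e208714657822bd09a284ef0267a12c4115b092d4676823b51a56092b42a6a14b40a96856b02c3c399c1d0e0a874914828a51bd209e947138289d0d12064943338191d0c520a258512a379413ca8e230511a19150cc6064343128269613528da704d3a17250bce05c742d4825a51ad211659452aa195,
  0x116684f30269a12d409aa8515044ac37ac1c160a0b48d6826b512da8dab04d5a17ac0b9685ad02e6a1834131b0ee3078182c0d254a0aa54532a3a8c154686e30361a1a940d8a87050542c31dc192e0897442ca126408b28477022ba115608aa845342398123e1ade0d8f04c7a44c412628cf10478a34bc125e859102a8a15bc,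
  0x115684eb0265a12b4099a848d84d2a25951b4609a342f18170d0b4a05c542c2c114508de044f4226c11350896846b0243c22a518d2086946538229d099284e70263a12a4114b09254672823951a46092342a2a158c0a8685250492c24a519d208e946938249d0ace05474294815250b130cf306898244d216a08b5443aa32cc,
  0x104e84290215210b2105a8c2b0415a10b9085a082d8418a30bc105e84310219210d22072083a461b820dd0878043a421c820d6106a8436421a820cd1866102f8c54a729c314e8cac4655831b1195494a90c34a71a420d308a54432a328c114684e30261a1294098a84858222a118c0886844582338111d089284898456a21b5,
  0x7916388b5e158e0ad691a2c8d5a358b22d58da2c4d5a168e0b5805a304d8f3187a0c35069de50cf2a788c344696850742a598c1d068e650722a5894344aa2250922cf58c7b0639835e728e3957a4639235ac28b6156ac62d8356b28b5156a4a392560928c51610428421021121092104a8c230411a1099084a08258414a309c,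
  0x6a0634e416822d4045a04b4a41662274124a0a1d065643292a039909c8896242d0a07049448322320f21189023c825e22310909044d0212820c71cc392618934e19860cd292a0c954a398324d18ea0c554a1a860d5406a10558eb58762c33169ced0c76a74ac3256958d06c6a55ac1b168d6d06a6a54b4325aa12d08a6cf1ac,
  0x4a4819248cb428694334c96070af4038212c0a0e064ad4037211b111ce80c742649932c8a1a10cd12580c2bc80e044b00838092b480dc446c24561c2ad00d8846c3235212a5018a896340a1a1614a28a65c132f19070c8c0a11c512e1a1814a38a65a838d3a05a10b50516832d2a059909d089283893a03a10b4871a340b221,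
  0x4ad01d8852c2876193ad01d485294064a2988e4c28241434094904cc48722340f221890a3c865e340f121885038288ea3874a03250acc716540a2a1788e3c281c142770c3b4819a456a18b4905248bcc31e520e29198864c2424122771c3b5019a85e638f2a07150ace414722c4845244a58312b2076114b021d824eb207511,
  0x99864ca424523318c98c848646850922898a0644e41e822f40c89483cc45e813140472032ce316818a40d59cc2d051482a77883c021a0156b10b6045302bce21e808e40598c44c812440a680d5306b90366419220d3bcc1e050d02ab5985b0a29855e730f414720acc662642922155a8e2d2814942b3a051d0b12514932961c,
  0x48d81c8c52448722938d81c4c5216060b230e0a0ad0c572543c29e00d104a868343929600cd04648460b930d8a0a90c552523c28e00c904647250c018a08c8c8a85853b01a1894ac0666234292a12190596f10b8045402adc316d20a69162c6296458d08a6894c0625e40f022780c4b481dc44f012980434034ce2268092405,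
  0x615228aa5285893b03a189d0b1256073313a14a5090c84c739c3a0e190756338b21c510e9cea0e848642558d42c891444a642d51169cee0e868643558dc2c8d1446ab13c5860283058168a0b9491e24700e4829234391c9c700e28290c030611c4f0e18060c139961cac0c562b12c5858282c4e67872c03160b02914152922c,
  0x394818a456218b09050489cc70e54062a1604228225241891903908a4810e41271903888a4240c124609930c8a0a10c512540c29c80d044a808340929480cc446424521c28d00c884643250a018908c888c3428294314c95050683252a019908d084a83853a02a112ce716838a41d59d42d091484ab32c595828ac58358a1b1,
  0x234a09a64303817a00b90860502e3216a012d08d6808b24b3885a02290156618b2905148b06314322c2845144a5031272074113a0624a40e62274094a0219018e71074043202ac6216408a2053206a8834e828641560ca288556238b0a05050b02514132921c48d01c8852428721938d01c485214060a2388e1c280c142730c,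
  0x1e020b01476183a9015489263053224a8415448703037201b110d4806c2438082a0615068e66074282a151c8e0e280514237a013d09225051321a1c0cd006484342819190c500a24873103a0415028e430712028911bc60de404f224884144486830332019110d0206424312026921c060a0346f303814140a8dc706d4026a1,
  0x13130ceb06858242d19dc0d0d0486a333c196008b04638021c1215a08ae4287813c009a0850d0267212c01159098b46b703634131a8d4f0698024c119e008f04896824b90b1e057002a8216340a9c853004964359c1b0e098746b50362413128d4b0696024b119d808ec4894824a90b16056c02a6214b00a94858904c2c3b88,
  0xa2604f4026a212d009a485110448c224d18ec0c95044aa315c18700838481a820d9092e0478022c2125408ac8438041a431bc191e088f46390324411228c53061a020d1206208324249811d008a88434022921244111b0de707038281d1bd40e090504a372c1b5809ac48b5825b1235209aa4305817b00b9885ac02e521824,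
  0x11d0912504932161c0ad0054842c2815190a50092486b10360413028d4306920249119c60ce40472244841244858302b2015110b0205424292022921a060903467303414120a8cc70654022a1214a08a64283813a0099085050263212a010d08c680832433bc1a1e090f46790344412228cd3065a022d120e608744858822c9,
  0x99485090444c222d20da088d4627830c01060902d04172123c08e004504246811390860082c86338321c110e8c6a06448222518960c2c0416240a41054848b0236011310858044a4244822161bc40e010500a370c1b4809a448b182591234209a24301817900b8885a402e1218041303098348b2826151a8e0d280494233a0,
  0x60931e620f4086a053c861e240d122778c3bc819e44b41859901d08968107412398c1cc80e444b1206889444212419eb10f6047302bd431e920e49179c63ce41c722d60c6ac82d845ac08b6095ac62d6416a22d4907244c12118a0c339c1a0e090746750342412128ccb0656022b120d6086c4854822a90a1604ec0266212b0,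
  0x31229c530e1a060d129261474064a2524419248c73063a03151286818325018841463ace1d870cc3a75a83b1219894ea5874b032589ceb0e76063b12b16156c06c6256241b148d6b06b6035312a58192a50948452678ce3c871c43af1a8791238895e258f0b07058b48b1a360b23169122c8a56358b1b05898b42c1c15300a4,
  0x311a9c2b0c15a5234191a946b0645a31b818da0c4d4a16860b5405a104d8eb18760c33069d660ec28661539cc1ce50c72a748c3246958506c2a558c1b068d6606b2835152a4a192550928451678c63c831c41af198790a38855e118e08d690a2c855a318b20d58cc2c651622ad094704ac0251822c71bc391e188f4e3907244,
  0x31129c4b0e16060b12916146c06462522419148c6b0636031312858182a5014841263ac41d810cc0a750c3a4819244e718739031c895830ab2036112b020d8246b1835901a8895240c912848422833c621e408e20578863c241c122d20c68c82c845a408b20958c62c6416222d0907044c0211820c71ac3916188b4e3707234,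
  0x19068c66063283115284a182550128411619c40d010480a330c194808a4483182191214208a2428181390098884a402612140411030c6206408220518860c240412240841044848302320111109020442421202092110690650442a311c18500828481282099090a0446421401121090e046802444719c390e18874e3507224,
  0x100a880346018400e181e080f460882045101b0c0d0406a202d1816100b860b8205d18320819440ac3054102a881346098404e0840082046100408208808460024047188390218814e2187090304894830a320321129020c82463183190188894240c112808420831c630e418620d38cc1c850c42a708c304694850642a518c,
  0xf680b7807ba03d602e681af80f7a07b604d682a78173a0b96080208014600840060804840302024100d080e040642028101a080e840902052102c0819040b420781039081a040e8207a104408248413020a4104d082e0416420a8105a0836041a420c8105d082f041b420e8206d1836101786038201d181208094402c3014,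
  0x1ee00d7403d202e4016d00f6407a409ac049681eb4115a08b4039b01ef00e7a05c9036201ae80f7207b2016e8077403ac02cd00e680af8075a04ad025b012f4077a03b6035e816f40b6c06ad02d681a780f1a088d044b022740f3a0796054682634132c099d054e826a415480a9a05ce02c74162c0b8d06468325017320b92,
  0x45482290122c098c048682650122a089c044c822500f320792015e806f4036c02ad00d680a78071a048d024b01274073a03960346816340b2c059d034e81a9817180b0d05ca02c5415380a99054a026641324098504c482a3015120a84054502e10160a0b0605c48323019120c8405c282e180b98054d01e68133409a80356,
  0x16e00b6405a801d900e900ef0067a03c401a280724059802c9016200d180b78053d02e201514079204cc0264813100a6c05ac0296816d00a6a04bc025c812d0077203b203c4822241118089203d601cb40f680735035e01ae40d6805b902d901e700e3a07a40392816a40d5806a9035201c981338091d04d2024940f5208ac,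
  0x15a006e40364019d014e806a4055802a9015200aa80738031d01d200c94064c078c038681e500e2a069c034c81a500b32059c02c9016140b180589034601a240d08068a03c201c140e0c09840482822100f0a07860286816500a2a0399024e0126409280516028e816900a4a03a90252012a4095804b201e600d3407a80355,
  0xd6008b803b8015d00f20059402ac01d400aa805340398024e00c080a080702038202c081a080f02078204c082a0817020b8201c600c3407280315014e00a640528019900c9006140312028c014480a1005140384018280c180b080505024200e14070c03890244812300924028d00c6806580758032d01da00cd4057802b9,
  0x4200414030802060044802300124008d004e002640128009a004e80290015200ac0059002b4017800b9005a002e8017a00c400648033001a400cd006e0036401a800da0076003a401c800dd006f003b401e8016d00f6009780338011d00d200494022c0194008a804340318020e00de004f403880145009b006d0026a012d,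
  0x695335259694ad3a869d22cea5aa38d49c5a8ead2916950752a685b3429ea12d30a5689e342f1627b511ca84e4c4756188b0c85895cc2926150f12a6b433521ea50d34856bc435e116f135388a9c24ce257108b8885a85cd2126910f50ad842ec2136111710a000680058003a001e0016800d8007a003e00268015800ba005e,
  0x286b242dca16c50c6285394298a12c9097684b34299614ad11c684e2c475a248d0a85894ac2916150712a2b4316218a90e5486294324a1da50cd4865a42b4e21a708b3896a82352216a12b4845a441d429a10cd087a8434c215a208d0885884d4412a111310958422c2216217308498443c428ad4c58962a53952d8a58c92a7,
  0x2a530d294a75053a419d495470a938351d2a92152a06a5234a41a540d4a8a710538419c495410a91035091a420d2206a1657882bc20de24b20858881c848e2107110390a28ae1437062ba30e418740c568a79053c419e4954f0a978353d1a620d3206a5657a82bd20dea4b238589c1c8e8e2907150391a2d4325a1ca10c9087,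
  0x50d5c4c722538f31d79543ca91e35311a888d2346a8f5107a843cc4a66113310a58b7b443da11eb1315888ac23562ae5117284b8c4e46232309518a2dc416e1077123c841e440ec28a208508818848c2106110310a288e14270623a512428540c4a4a27850bc189e94510a190314918520c2a0625630c418640c528a54c5496,
  0xb886e44332119510e498e24a70e63a932449541cca4e55072a438d4a46a1234851aa4b8225a20ee1276883b421d6252b1095842ac524c112510730939441ca10e312918448c42862e260912887984bca21e508f18988c444611a314971c4b4e1dc74ed5076a43ad4a56a12b4855aa499e24af0e67a72c839621c725238891c8,
  0x2a872445121307119384c1c250e21a908c48862843e22291098788cbc261e128f10d888644231a21c93b849da1cee4e97074b43a96a54b12958552e386c1c350e29a90cc48a6284bde170f0b47896c44b22158d12e4bcc25e50ef3278983c4a1e4353118990c5287c4e622728f3997a4c3d251ea1b150c8a463543ae1317094,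
  0x389e9c310e1907149486424511424f111c884e3c475e148f0a87894c44922150d12a4bc425e10ef1278843c441e425311099045283c4e222708f3897a423d221ea1315048a443542ae1097088b884e44132111510a489a242e0e27270b8385a1c4b5225890ac289724e61272873994a8a25260ea3274983a4a1d4352a18948c,
  0xb9e05af04b7a15c40ae4096ac2d6c16a70d4b06a7436381a9c14ce866a03348199a488e24270e23a70a438541c4a5224890a8289524e21270873893a421d220ea1295044a4415428e10870883884a42212208a10778423c221e2131104884434429275093a439d4a54712938751d3a521d2a0ea5295244a54154a9227890bc,
  0x10ce84c90255021a908d2046a04356133c095e086f4268812c810e484720238811ca0a5b04b18254e12a60a4b0525c312c16a60b5285c702d38259d0b9205aa04b5215a80ad2056a8250c14870b8205a204b1215840ac40962c2d0c16870d4306a1436081a8814c4866203308198a09ae04b7043ba11e808f20476825ac14b7,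
  0xc8f042602228210d088604230221c10960853842d8216a10b8089a084b42158112c10978435821aa10d808aa08534229810cc08a7054d0297023b909dc04ed0475a152c0a56054b82a28149811cc84e602728238d0a46054304a1e19140c4c09e642f30179413c6864303118190e098204a204312118808c2046282638129c,
  0xc4e09e742f4817a813d4864903150191a0842844102110110a084e04470423a10a808920849c2178113c109e845102190114a0a8e05270473a13a409d408ea42a4814a80a9504e10271023890a44054104a0e17840bc409e24320818880c85043b422d810ec08af04f6027a823cd0a66055304a5e17b80bda09eb4325818ac,
  0x685c2c4e56168b0b8389d2d255a730d39459ccb5431a918b50d6a8a352616a32b4945a4c1d46a612b510ca8464c436a2295098988ccc2526130f11a0dc206e2057121d040e4406c2837301b9415c68743039181b0e0ec2876203b081b8a086e0457042ba11640874045682a7814bc11de84f10279023c90a64055104a4e191c,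
  0x6b442dc256d08b6883b854ca16a311518498c4d4c12a511330999424ca21e614b2b568dc346d16372d32c69562ccb56568b2b8399d2da55ab30d5945accb5c31ad18b70d5b4a2da60ee353295a8cc546526333530ca9464cc3665293298798d2c255a218d08c5886b4451a130b119584a2c260e234b0b56896342b1625ad134,
  0x1a5a0d4b4aa5854ac2a8f44c322518f30d898a44a61e632f298794a3c6662331119468cd35635650ad18868c22c625a608d2885984aca116510730a694b2ca55a330d19458ccb4c31a518b30d698a34a616632b294594c1cc69654ad1a868d22c6a5a638d29c598eb4c91a550b32959522caa0e654b6856ac4356116b12d704,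
  0x2d460ec3475303a941ccc96660b328579a294b8c254a218508c18868c25061303119288a14260a23430b52896142b0625a30b4185c0c4e4a26850b8289d0d254a730539419cc95430a918350d1a4a0d2606a3255142a4c1546861aa5154286c0c56461b030d418a694530a198513e1a5a94ee0a76833b92a9a152e06a7234b8,
  0x19540cca4a64852a829950da14ab1055841ac48da106d1037092b8215a20ae1436a52b8e15a706e3a57242b540dca46d5036a41ad4956a0ab4853aa1d4296c10b5103b091d440ea10731259882cc215e2865aa51d828ea0c76465b032d419a694d30a598533e1b5a956e0ab6835b91b5c0dad06e5a572c2b5615c78752a5b0c,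
  0x2b4b0e254af3057941bcc96430b118390d2c8a16260723238941c4c0dc686d2a570c2b460dc34ae2856981b8c8da606d2835992acc15650a734930c49461cc3526289298398c9ca60e528719948cc24650a334519828ca0c664a618528c198694c50a5303319194a0ca60663452961952946a0a34831a9298e14a70663a32a4,
  0x28c4146106312328419440cc24a6085288298524cb12558732d499a24ae0e67272b8395a1c6e5237091b428dd14ad8658a51c828e20c724a67852bc199e94d10a590334919620cb20667432b528dc146d063725334295c0cce4657032b4199694cb0a558531e4b8625a30ee1a97144b4c1dc64ed3076943acca56612b28559a,
  0x98604a30431a119408cc0866426281298098d04ad4265812ac10d6846d0237021b9099a04ae0267416950b8605a304b1a15940acc096642e2816980b8d04b5426a812d810ec8476023a821cd09a604b30267c16b50b9a05ae04b7215b80ada096b42e5816ac0b8f06a5436181a8c14c686c50353029990ccc066502f343285,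
  0x186f0d2bc713c308e18578c338695c348f1c470c618634e31c61ad30d61c730c31d61ad38e658e14c74865843bc219693a74a6585eac29de14cb7855a43bd21ae10cb0ad38572d234e91cb08d5847bc238e95cb0af78572de35691ef48eb8471c6996b0a758658c2ac61de30cb59d3ad32c6f5634ef1a65ac3bd61ae30c1295,
  0x8c7046bc239c15ad0ad7056342b1e198e285715239211ed08e2a57242bde15ad0ae4bc6a523de91ad48ea84714698ab0c918768c325674ab4c91bd48d3b46992b0ef5856ac354619235a51ae4ac695639231a918f68c7156b9235ed1ae4ac7bd635ab1d518e1d430ea3861ac34a71c4b0ee18610c30a718630d298690e3886,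
  0x38439c2fce13a709638469c25ce13e71c5395e9ca9de10e738539431c614e50e73bd395f1c734e55e719539469ca3ee11af09739c39ce9de13f71857943dc635e51ef38748cea4a78370c1b8e0d4704378295e17ad0c4f04238215e10ce0a570523c311c11d60ade8569c332c118608d3847182b4c15870cc3047782b5e199e,
  0x784f4c275613e319798c6cca35e51cf18d78cb3c695e52d3195594bbc6b5e53d319d594fbce15e70d338559c3bce75e72d338d59cbb4e19670a73863ac29da18ef0a748758cb9de54f11a749769cf2ceb4e76c75ad3b4f1de74e93e77863cc29da1da13cb09d384f1c2b4e16c70bd38539de58f31a768f385f1c334e16e7787,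
  0x28db0c714657a32a718468c25c677a34bd195f0c6f4a37c31cd19668cabc63aa32b718c28ca1c63ba32bf185694278613a309f18c68ca34a51c33951a468ca58653a31a528cb0c654652e519e18ce8ca7c636e33c519d38d614a70c338519c38d6f4a77c33cd19dbbc235e12d308d584b8ce34672ef18579434c615650ef09d,
  0x3a4f1d2b4e55c72ad38da9c6d9636ab2ad594f2c675a33cd1ad694f3ca75e33a919f1bc295e18730a36871d468e634af1c378d1bca8de586f3a37a52bcb0e6546d2e37ad2bcf0e6746d3e568e1c468d25c770a37871dc68de5cad3c389d1a4f8c2f4a17c30cd185b8d65c61ba30bf1a4e8ca78636a32ad195b0d2b4a55c51ad,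
  0x1b4e8d694ab2c558d29c71ce34e72a939619d68ced4676c35b51b568da786b3a559e2ad694ed8e76a73ad49cf1ce74e74a73a63b4e9d694eb2c75953b469da396d1ab59559cb2ce75674ad39659caace35a71cf38d79caa4e5d634ab29d39532c635632a719638d29ca74e52cb28d69473ca35e32a919739471d234e92c749d,
  0x58cfbce39671e778e3ac79c6f8e35e718e38c7bc63c2f0e1b8d0bcb85e7c2f1a17960cc68565c2f3a179e0cce8567c217e109f08de84af8239a11b70b4f05674273c13ad09db04ef4274e11dd08df84ef8279a13b709c384efc235a129e09ce84e58271a139709cf84634232e739e08ce8467c673a33a519cb0d6546d1a3696,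
  0x6f1e378e1ac78de786b3e31be18d78c6fc631e33be19d78c678633e338e19c7bc639631ef19e]

/-- Sums of Steenrod squares of monomials that `learn` uses at the end. -/
def sums32 : List (List (ℕ × Expo)) := [
  [(8, 3, 7, 7, 7), (4, 3, 7, 7, 11), (4, 3, 7, 11, 7)],
  [(8, 7, 3, 7, 7), (4, 7, 3, 7, 11), (4, 7, 3, 11, 7)],
  [(8, 7, 7, 3, 7), (4, 7, 7, 3, 11), (4, 7, 11, 3, 7)],
  [(8, 7, 7, 7, 3), (4, 7, 7, 11, 3), (4, 7, 11, 7, 3)],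
  [(4, 7, 3, 11, 7)],
  [(4, 7, 11, 3, 7)],
  [(4, 3, 7, 11, 7)],
  [(4, 11, 7, 3, 7)],
  [(4, 7, 7, 11, 3)],
  [(4, 3, 11, 7, 7)],
  [(4, 11, 3, 7, 7)],
  [(4, 7, 11, 7, 3)]]

/-- The points and directions of the derivatives that are used in degree `32`. -/
def directions : List ((Bool × Bool × Bool × Bool) × Fin 4) :=
  [false, true].flatMap fun p => [false, true].flatMap fun q => [false, true].flatMap fun r =>
    [false, true].flatMap fun s => [0, 1, 2, 3].map fun j => ((p, q, r, s), j)

/-- Functionals on the polynomials of degree `32`. -/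
def code32 (e : Expo) : ℕ := packBits 1 derivCode directions e ^^^ halfCode code14 e <<< 64

/-- The low 64 bits are the derivatives at 16 points in four directions, one bit each; the 50 bits
above them come from degree 14 through the Kameko homomorphism. -/
theorem code32_killsHits : KillsHits 32 code32 :=
  (KillsHits.packBits 1 fun x _ => derivCode_killsHits x).xor
    (code14_killsHits.halfCode.shiftLeft 64)

theorem deg_basis32 : ∀ e ∈ basis32, Expo.deg e = 32 := by decide +kernel

/-- There are 6545 = C(35, 3) monomials of degree 32. -/
theorem learnAll32 : learnAll 32 basis32 squares32 sums32 = 2 ^ 6545 - 1 := by decide +kernel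

theorem bitsIndep32 : bitsIndep 95 (basis32.map code32) = true := by decide +kernel

/-- The basis of `(QP_4)_32`. -/
def cohitBasis32 : CohitBasis 32 where
  B := basis32
  C := code32
  deg_eq := deg_basis32
  spans := polyDeg_le_of_learnAll (N := 6545) rfl deg_basis32 learnAll32
  kills := code32_killsHits
  indep := ⟨95, bitsIndep32⟩

/-! ### The invariants -/

/-- The exponents in `Sigma_4[1], ..., Sigma_4[11]`. -/
def sigmaExpos : Fin 11 → List Expo := ![
  [(1, 2, 1, 28), (1, 2, 28, 1), (1, 2, 4, 25), (1, 2, 5, 24), (1, 3, 4, 24), (3, 1, 4, 24)],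
  [(1, 2, 29, 0), (1, 2, 0, 29), (1, 3, 28, 0), (1, 3, 0, 28), (1, 30, 1, 0), (1, 30, 0, 1), (1,
    0, 2, 29), (1, 0, 3, 28), (1, 0, 30, 1), (3, 1, 28, 0), (3, 1, 0, 28), (3, 0, 1, 28), (0, 1,
    2, 29), (0, 1, 3, 28), (0, 1, 30, 1), (0, 3, 1, 28)],
  [(1, 1, 15, 15), (1, 15, 1, 15), (1, 15, 15, 1), (15, 1, 1, 15), (15, 1, 15, 1), (15, 15, 1, 1)],
  [(1, 15, 3, 13), (1, 3, 13, 15), (1, 3, 15, 13), (15, 1, 3, 13), (15, 3, 1, 13), (15, 3, 13,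
    1), (3, 1, 13, 15), (3, 1, 15, 13), (3, 13, 1, 15), (3, 13, 15, 1), (3, 15, 1, 13), (3, 15,
    13, 1)],
  [(15, 3, 5, 9), (3, 15, 5, 9), (3, 5, 15, 9), (3, 5, 9, 15)],
  [(15, 3, 7, 7), (15, 7, 3, 7), (15, 7, 7, 3), (3, 15, 7, 7), (3, 7, 15, 7), (3, 7, 7, 15), (7,
    15, 3, 7), (7, 15, 7, 3), (7, 3, 15, 7), (7, 3, 7, 15), (7, 7, 15, 3), (7, 7, 3, 15)],
  [(1, 1, 2, 28), (1, 2, 4, 25), (1, 2, 5, 24), (1, 3, 4, 24), (3, 1, 4, 24)],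
  [(3, 29, 0, 0), (3, 0, 29, 0), (3, 0, 0, 29), (0, 3, 29, 0), (0, 3, 0, 29), (0, 0, 3, 29)],
  [(1, 31, 0, 0), (1, 0, 31, 0), (1, 0, 0, 31), (31, 1, 0, 0), (31, 0, 1, 0), (31, 0, 0, 1), (0,
    1, 31, 0), (0, 1, 0, 31), (0, 31, 1, 0), (0, 31, 0, 1), (0, 0, 1, 31), (0, 0, 31, 1)],
  [(1, 7, 11, 13), (7, 1, 11, 13), (7, 11, 1, 13), (7, 11, 13, 1)],
  [(3, 3, 13, 13), (7, 7, 9, 9)]]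

/-- The exponents in `gen14`. -/
def genExpos : List Expo := [(1, 1, 6, 6), (3, 3, 4, 4)]

theorem gen14_eq_listPoly : gen14 = listPoly genExpos := by
  simp [listPoly, genExpos, gen14, expoMono]

theorem sigma4_eq_listPoly (j : Fin 11) : sigma4 j = listPoly (sigmaExpos j) := by
  fin_cases j <;>
    simp only [sigma4, sigmaExpos, Fin.reduceFinMk, Matrix.cons_val, listPoly, List.map_cons,
      List.map_nil, List.sum_cons, List.sum_nil, expoMono, add_zero, add_assoc]

theorem deg_genExpos : ∀ e ∈ genExpos, Expo.deg e = 14 := by decide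

theorem deg_sigmaExpos : ∀ j, ∀ e ∈ sigmaExpos j, Expo.deg e = 32 := by decide +kernel

theorem QP.mk_congr {k n : ℕ} {f g : Poly k} (h : f = g) (hf : f.IsHomogeneous n)
    (hg : g.IsHomogeneous n) : (QP.mk f hf : QP k n) = QP.mk g hg := by
  subst h
  rfl

/-- The transpositions of adjacent variables. -/
def swaps : List Move := [.swap 0, .swap 1, .swap 2]

/-- Generators of the general linear group. -/
def generators : List Move := .shear 0 1 :: swaps

theorem valid_swaps : ∀ m ∈ swaps, m.Valid := by
  simp [swaps, Move.Valid]

theorem valid_generators : ∀ m ∈ generators, m.Valid := by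
  simp [generators, swaps, Move.Valid]

/-- The defect of the class is computed for each of the twelve transvections; since codes are
injective, zero defect means that the class is fixed. -/
theorem matAction_gen14 (i j : Fin 4) (hij : i ≠ j) :
    matAction 4 14 (Move.shear i j).mat (QP.mk gen14 gen14_isHomogeneous) =
      QP.mk gen14 gen14_isHomogeneous := by
  have hd : ∀ i j : Fin 4, i ≠ j →
      xorSum (CohitBasis.defect code14 (.shear i j)) genExpos = 0 := by decide +kernel
  have h := gen14_eq_listPoly ▸ gen14_isHomogeneous
  rw [QP.mk_congr gen14_eq_listPoly gen14_isHomogeneous h]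
  exact cohitBasis14.matAction_mk_eq (m := .shear i j) hij deg_genExpos (hd i j hij) h

theorem matAction_sigma4_last (i j : Fin 4) (hij : i ≠ j) :
    matAction 4 32 (Move.shear i j).mat (QP.mk (sigma4 10) (sigma4_isHomogeneous 10)) =
      QP.mk (sigma4 10) (sigma4_isHomogeneous 10) := by
  have hd : ∀ i j : Fin 4, i ≠ j →
      xorSum (CohitBasis.defect code32 (.shear i j)) (sigmaExpos 10) = 0 := by decide +kernel
  have h := sigma4_eq_listPoly 10 ▸ sigma4_isHomogeneous 10
  rw [QP.mk_congr (sigma4_eq_listPoly 10) (sigma4_isHomogeneous 10) h]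
  exact cohitBasis32.matAction_mk_eq (m := .shear i j) hij (deg_sigmaExpos 10) (hd i j hij) h

theorem matAction_swap_sigma4 (k : Fin 3) (j : Fin 11) :
    matAction 4 32 (Move.swap k).mat (QP.mk (sigma4 j) (sigma4_isHomogeneous j)) =
      QP.mk (sigma4 j) (sigma4_isHomogeneous j) := by
  have hd : ∀ (k : Fin 3) (j : Fin 11),
      xorSum (CohitBasis.defect code32 (.swap k)) (sigmaExpos j) = 0 := by decide +kernel
  have h := sigma4_eq_listPoly j ▸ sigma4_isHomogeneous j
  rw [QP.mk_congr (sigma4_eq_listPoly j) (sigma4_isHomogeneous j) h]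
  exact cohitBasis32.matAction_mk_eq (m := .swap k) trivial (deg_sigmaExpos j) (hd k j) h

theorem code_gen14 :
    cohitBasis14.code (QP.mk gen14 gen14_isHomogeneous) = bits (xorSum code14 genExpos) := by
  rw [CohitBasis.code_mk, gen14_eq_listPoly]
  exact codeMap_listPoly _ deg_genExpos

theorem code_sigma4 (j : Fin 11) :
    cohitBasis32.code (QP.mk (sigma4 j) (sigma4_isHomogeneous j)) =
      bits (xorSum code32 (sigmaExpos j)) := by
  rw [CohitBasis.code_mk, sigma4_eq_listPoly]
  exact codeMap_listPoly _ (deg_sigmaExpos j)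

theorem gen14_ne_zero : (QP.mk gen14 gen14_isHomogeneous : QP 4 14) ≠ 0 := by
  intro h
  have h1 := code_gen14
  rw [h, map_zero, ← bits_zero] at h1
  have h2 : xorSum code14 genExpos ≠ 0 := by decide +kernel
  exact h2 (bits_injective h1).symm

/-- Independence may be tested after applying the code map, where it is an elimination on eleven bit
vectors. -/
theorem linearIndependent_sigma4 : LinearIndependent (ZMod 2)
    fun j => (QP.mk (sigma4 j) (sigma4_isHomogeneous j) : QP 4 32) := by
  refine LinearIndependent.of_comp cohitBasis32.code ?_
  have hi : bitsIndep 11 (List.ofFn fun j => xorSum code32 (sigmaExpos j)) = true := by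
    decide +kernel
  have h := (linearIndependent_of_bitsIndep hi).comp
    (Fin.cast (List.length_ofFn (f := fun j => xorSum code32 (sigmaExpos j))).symm)
    (Fin.cast_injective _)
  convert h using 1
  funext j
  simp only [Function.comp_apply, code_sigma4, Fin.getElem_fin, Fin.val_cast, List.getElem_ofFn]

theorem gl_invariants14 : Module.finrank (ZMod 2) (glRep 4 14).invariants = 1 ∧
    (glRep 4 14).invariants = Submodule.span (ZMod 2) {QP.mk gen14 gen14_isHomogeneous} := by
  -- The monomial left out is a term of `gen14`. One shear and the three swaps already bound the
  -- invariants; that they generate the group is not needed here.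
  have hr : bitsIndep 49 ((basis14.drop 1).map
      (packBits 50 (CohitBasis.defect code14) generators)) = true := by decide +kernel
  have := cohitBasis14.eq_span_of_fixed (glRep 4 14).invariants 50 generators valid_generators
    (fun v hv m hm => matAction_mat_of_glRep hv (valid_generators m hm)) (r := 1) hr
    (by decide +kernel) (f := fun _ => QP.mk gen14 gen14_isHomogeneous)
    (LinearIndependent.of_subsingleton 0 gen14_ne_zero)
    fun _ => mem_glRep_invariants matAction_gen14
  rwa [Set.range_const] at this

theorem sym_invariants32 : Module.finrank (ZMod 2) (symRep 4 32).invariants = 11 ∧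
    (symRep 4 32).invariants = Submodule.span (ZMod 2)
      (Set.range fun j => (QP.mk (sigma4 j) (sigma4_isHomogeneous j) : QP 4 32)) := by
  -- The eleven monomials left out are one term from each of the eleven polynomials. Codes have 64 +
  -- 50 = 114 bits, which is the block length.
  have hr : bitsIndep 84 ((basis32.drop 11).map
      (packBits 114 (CohitBasis.defect code32) swaps)) = true := by decide +kernel
  refine cohitBasis32.eq_span_of_fixed (symRep 4 32).invariants 114 swaps valid_swaps
    (fun v hv m hm => ?_) hr (by decide +kernel) linearIndependent_sigma4
    fun j => mem_symRep_invariants fun k => matAction_swap_sigma4 k j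
  simp only [swaps, List.mem_cons, List.not_mem_nil, or_false] at hm
  rcases hm with rfl | rfl | rfl <;> exact matAction_swap_of_symRep hv _

theorem gl_invariants32 : Module.finrank (ZMod 2) (glRep 4 32).invariants = 1 ∧
    (glRep 4 32).invariants =
      Submodule.span (ZMod 2) {QP.mk (sigma4 10) (sigma4_isHomogeneous 10)} := by
  -- Only the first monomial, a term of the last polynomial, is left out now that a shear is added
  -- to the swaps.
  have hr : bitsIndep 94 ((basis32.drop 1).map
      (packBits 114 (CohitBasis.defect code32) generators)) = true := by decide +kernel
  have := cohitBasis32.eq_span_of_fixed (glRep 4 32).invariants 114 generators valid_generators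
    (fun v hv m hm => matAction_mat_of_glRep hv (valid_generators m hm)) (r := 1) hr
    (by decide +kernel) (f := fun _ => QP.mk (sigma4 10) (sigma4_isHomogeneous 10))
    (LinearIndependent.of_subsingleton 0 (linearIndependent_sigma4.ne_zero 10))
    fun _ => mem_glRep_invariants matAction_sigma4_last
  rwa [Set.range_const] at this

/-! ### The Kameko homomorphism -/

theorem psi_apply (u : Poly 4) : psi 4 u = (∏ j, MvPolynomial.X j) * u ^ 2 :=
  rfl

/-- The rule K(f g^2) = K(f) g with f the product of all variables, for which K(f) = 1. -/
theorem kamekoPoly_psi (u : Poly 4) : kamekoPoly 4 (psi 4 u) = u := by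
  have h : (∏ j, MvPolynomial.X j : Poly 4) = expoMono (1, 1, 1, 1) := by
    rw [Fin.prod_univ_four]
    simp [expoMono, mono]
  rw [psi_apply, kamekoPoly_mul_sq, h, kamekoPoly_expoMono, if_pos (by decide)]
  simp [expoMono, mono]

theorem psi_isHomogeneous {u : Poly 4} {n m : ℕ} (h : n = 2 * m + 4) (hu : u.IsHomogeneous m) :
    (psi 4 u).IsHomogeneous n := by
  have hn : n = 4 + m * 2 := by omega
  have h1 : (∏ j, MvPolynomial.X j : Poly 4) = mono 1 1 1 1 := by
    rw [Fin.prod_univ_four]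
    simp [mono]
  rw [psi_apply, h1, hn]
  exact (mono_isHomogeneous rfl).mul (hu.pow 2)

/-- Any representative u lifts to ψ(u). Only a preimage of each class is needed, so ψ does not have
to respect hit polynomials. -/
theorem kameko_surjective {n m : ℕ} (h : n = 2 * m + 4) :
    Function.Surjective (kameko 4 n m h) := by
  intro v
  obtain ⟨⟨u, hu⟩, rfl⟩ := Submodule.mkQ_surjective _ v
  refine ⟨QP.mk (psi 4 u) (psi_isHomogeneous h hu), ?_⟩
  exact congrArg (hitsDeg 4 m).mkQ (Subtype.ext (kamekoPoly_psi u))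

theorem psi_gen14 : psi 4 gen14 = mono 3 3 13 13 + mono 7 7 9 9 := by
  rw [psi_apply, Fin.prod_univ_four, gen14, CharTwo.add_sq]
  simp only [mono]
  ring

theorem kameko_sigma4_last : kameko 4 32 14 rfl (QP.mk (sigma4 10) (sigma4_isHomogeneous 10)) =
    QP.mk gen14 gen14_isHomogeneous := by
  refine congrArg (hitsDeg 4 14).mkQ (Subtype.ext ?_)
  change kamekoPoly 4 (mono 3 3 13 13 + mono 7 7 9 9) = gen14
  rw [← psi_gen14, kamekoPoly_psi]

end HitProblem

theorem mainTheorem2 :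
    -- the Kameko homomorphism in degree `32` is onto, and its target has invariants `⟨[gen14]⟩`
    Function.Surjective (kameko 4 32 14 rfl) ∧
    Module.finrank (ZMod 2) (glRep 4 14).invariants = 1 ∧
    (glRep 4 14).invariants = Submodule.span (ZMod 2) {QP.mk gen14 gen14_isHomogeneous} ∧
    -- the cohit space in degree `32`
    Module.finrank (ZMod 2) (QP 4 32) = 95 ∧
    -- the eleven classes are a basis of the invariants of the symmetric group
    Module.finrank (ZMod 2) (symRep 4 32).invariants = 11 ∧
    LinearIndependent (ZMod 2)
      (fun j => (QP.mk (sigma4 j) (sigma4_isHomogeneous j) : QP 4 32)) ∧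
    (symRep 4 32).invariants = Submodule.span (ZMod 2)
      (Set.range fun j => (QP.mk (sigma4 j) (sigma4_isHomogeneous j) : QP 4 32)) ∧
    -- the invariants of the general linear group
    Module.finrank (ZMod 2) (glRep 4 32).invariants = 1 ∧
    psi 4 gen14 = mono 3 3 13 13 + mono 7 7 9 9 ∧
    sigma4 10 = mono 3 3 13 13 + mono 7 7 9 9 ∧
    (glRep 4 32).invariants =
      Submodule.span (ZMod 2) {QP.mk (sigma4 10) (sigma4_isHomogeneous 10)} ∧
    -- the invariants in the kernel of the Kameko homomorphism
    LinearMap.ker (kameko 4 32 14 rfl) ⊓ (glRep 4 32).invariants = ⊥ := by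
  refine ⟨kameko_surjective rfl, gl_invariants14.1, gl_invariants14.2, cohitBasis32.finrank_eq,
    sym_invariants32.1, linearIndependent_sigma4, sym_invariants32.2, gl_invariants32.1,
    psi_gen14, rfl, gl_invariants32.2, ?_⟩
  rw [eq_bot_iff]
  rintro v ⟨hv, hvI⟩
  rw [SetLike.mem_coe, gl_invariants32.2] at hvI
  -- An invariant is c times the generator, and its Kameko image is c times the nonzero class of
  -- `gen14`; lying in the kernel forces c = 0.
  obtain ⟨c, rfl⟩ := Submodule.mem_span_singleton.1 hvI
  rw [SetLike.mem_coe, LinearMap.mem_ker, map_smul, kameko_sigma4_last] at hv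
  rw [(smul_eq_zero.1 hv).resolve_right gen14_ne_zero, zero_smul]
  exact Submodule.zero_mem _
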